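/- Let $\omega$ be a random variable with values in $[0,2\pi)$ whose distribution has a density $p_\omega$ on $[0,2\pi)$ with respect to Lebesgue measure. Let $n\ge 1$ and let $\rho$ be a partition of $\{1,\dots,n\}$ into $|\rho|$ blocks; for $1\le k\le n$ let $b(k)$ be the block of $\rho$ containing $k$, and put $b(0)=b(n)$. For $N\ge 1$ define $$K_{\rho,\omega,N}=\frac{1}{N^{\,n+1-|\rho|}}\;\mathbb{E}\left[\prod_{k=1}^n\frac{1-e^{jN(\omega_{b(k-1)}-\omega_{b(k)})}}{1-e^{j(\omega_{b(k-1)}-\omega_{b(k)})}}\right],$$ where $j=\sqrt{-1}$, the variables $\omega_W$, indexed by the blocks $W$ of $\rho$, are i.i.d. with the distribution of $\omega$, and a factor of the form $0/0$ is given its limiting value $N$. When the limit exists, put $K_{\rho,\omega}=\lim_{N\to\infty}K_{\rho,\omega,N}$. Let $u$ be the uniform distribution on $[0,2\pi)$, and let $K_{\rho,u}$ be the same limit with $u$ in place of the distribution of $\omega$. If $p_\omega$ is continuous and bounded on $[0,2\pi)$, then for every $n\ge1$ and every partition $\rho$ of $\{1,\dots,n\}$ the limits $K_{\rho,u}$ and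 $K_{\rho,\omega}$ exist, and $$K_{\rho,\omega}=K_{\rho,u}\,(2\pi)^{|\rho|-1}\int_0^{2\pi}p_\omega(x)^{|\rho|}\,dx .$$ -/

import Mathlib

open MeasureTheory Filter Topology

noncomputable section

/-- The factor `(1 - e^{jNθ}) / (1 - e^{jθ})`, extended continuously by the value `N` to the
points `θ ∈ 2πℤ`, where the quotient has the form `0 / 0`. -/
def vandermondeKernel (N : ℕ) (θ : ℝ) : ℂ :=
  if Complex.exp (Complex.I * θ) = 1 then (N : ℂ)
  else (1 - Complex.exp (Complex.I * (N * θ))) / (1 - Complex.exp (Complex.I * θ))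

/-- The kernel is the trigonometric polynomial `∑_{0 ≤ i < N} e^{jiθ}`; in particular `N` is the
right value at `θ ∈ 2πℤ`. -/
theorem vandermondeKernel_eq_sum (N : ℕ) (θ : ℝ) :
    vandermondeKernel N θ = ∑ i ∈ Finset.range N, Complex.exp (Complex.I * θ) ^ i := by
  unfold vandermondeKernel
  split_ifs with h
  · simp [h]
  · have h' : (1 : ℂ) - Complex.exp (Complex.I * θ) ≠ 0 := fun h0 => h (sub_eq_zero.mp h0).symm
    rw [div_eq_iff h', geom_sum_mul_neg, ← Complex.exp_nat_mul]
    congr 2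
    ring

/-- The block `b(k)` of the partition `ρ` that contains `k`. -/
def blockOf {n : ℕ} (ρ : Finpartition (Finset.univ : Finset (Fin n))) (k : Fin n) :
    {W : Finset (Fin n) // W ∈ ρ.parts} :=
  ⟨ρ.part k, ρ.part_mem.2 (Finset.mem_univ k)⟩

/-- The quantity `K_{ρ,ω,N}`, for a phase distribution `ω` with law `μ`. The integration variables
`x` are indexed by the blocks of `ρ` and are i.i.d. with law `μ`. The set `{1, …, n}` is represented
by `Fin n`, in which `k - 1` is cyclic. -/
def expansionCoeff {n : ℕ} [NeZero n] (ρ : Finpartition (Finset.univ : Finset (Fin n)))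
    (μ : Measure ℝ) (N : ℕ) : ℂ :=
  1 / (N : ℂ) ^ (n + 1 - ρ.parts.card) *
    ∫ x : {W : Finset (Fin n) // W ∈ ρ.parts} → ℝ,
      ∏ k : Fin n, vandermondeKernel N (x (blockOf ρ (k - 1)) - x (blockOf ρ k))
      ∂(Measure.pi fun _ => μ)

/-- `K` is the Vandermonde mixed moment expansion coefficient `K_{ρ,ω}`: the limit of
`K_{ρ,ω,N}` as `N → ∞` exists and equals `K`. -/
def IsExpansionCoeff {n : ℕ} [NeZero n] (ρ : Finpartition (Finset.univ : Finset (Fin n)))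
    (μ : Measure ℝ) (K : ℂ) : Prop :=
  Tendsto (expansionCoeff ρ μ) atTop (𝓝 K)

/-- The uniform distribution `u` on `[0, 2π)`. -/
def uniformPhase : Measure ℝ :=
  ProbabilityTheory.cond volume (Set.Ico 0 (2 * Real.pi))

end

/-! Read `b` as a closed walk through the blocks, with an edge `b (k - 1) → b k` carrying a number
`i k` in `{0, …, N - 1}`. Expanding the kernels as geometric sums turns the expectation into a sum
over such flows `i` of the product over `W` of the Fourier coefficients of the law at the
divergences of `i` (`prod_circleKernel_eq`, `walkIntegral_eq_sum`).

Flows of divergence zero are the lattice points of a dilated convex body of dimension `n + 1 - |ρ|`,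
so their normalized number tends to a volume `V` (`exists_tendsto_flowCount_zero`). Translating by a
fixed flow shows that every divergence of total zero has the same asymptotic count
(`tendsto_flowCount`); other divergences do not occur. If the density relative to Haar measure is a
trigonometric polynomial `f`, only finitely many divergences contribute, and the limit is `V` times
the sum of the coefficient products over frequencies of total zero, which is `V ∫ f ^ |ρ|`
(`tendsto_walkIntegral_trigPoly`).

Bounded measurable `f` are reached by `L¹` approximation, which requires control uniform in `N`
(`exists_norm_walkIntegral_sub_le`). A spanning tree of the walk makes the kernel factors
independent, but the `L¹` norm of one factor loses a logarithm. Since the walk is closed, some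
spanning tree avoids the smallest factor; spreading that factor over the tree raises each exponent
to `1 + 1/n`, and the loss disappears (`prod_le_sum_prod_tree`,
`exists_integral_prod_kernelRatio_le`).

The uniform law is `f = 1`, with limit `V`; the given law is `f = 2πp`, and normalizing Haar measure
leaves the factor `(2π) ^ (|ρ| - 1)`. -/

/-- The net increase of `i` across the visits of the closed walk `b` to `W`. -/
def flowDivergence {n : ℕ} [NeZero n] {B R : Type*} [DecidableEq B] [AddCommGroup R]
    (b : Fin n → B) (i : Fin n → R) (W : B) : R :=
  ∑ k with b k = W, (i (k + 1) - i k)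

/-- The steps at which the closed walk `b`, started at `b (-1)`, reaches a vertex for the first
time. The edges `b (k - 1) → b k`, for `k` in this set, form a spanning tree. -/
def firstVisits {n : ℕ} [NeZero n] {B : Type*} [DecidableEq B] (b : Fin n → B) : Finset (Fin n) :=
  {k | b k ≠ b (-1) ∧ ∀ l < k, b l ≠ b k}

/-! ### Integral flows on a closed walk -/

section Walk

variable {n : ℕ} [NeZero n] {B : Type*} [DecidableEq B] (b : Fin n → B)

theorem mem_firstVisits {k : Fin n} :
    k ∈ firstVisits b ↔ b k ≠ b (-1) ∧ ∀ l < k, b l ≠ b k := by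
  simp [firstVisits]

theorem Fin.lt_add_one_of_ne_neg_one {k : Fin n} (hk : k ≠ -1) : k < k + 1 := by
  obtain ⟨m, rfl⟩ := Nat.exists_eq_succ_of_ne_zero (NeZero.ne n)
  refine Fin.lt_add_one_iff.2 (lt_of_le_of_ne (Fin.le_last k) ?_)
  intro h
  apply hk
  rw [h, eq_neg_iff_add_eq_zero, Fin.last_add_one]

theorem Fin.add_one_le_of_lt_of_neZero {k m : Fin n} (h : k < m) : k + 1 ≤ m := by
  obtain ⟨N, rfl⟩ := Nat.exists_eq_succ_of_ne_zero (NeZero.ne n)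
  exact Fin.add_one_le_of_lt h

theorem Fin.le_neg_one (k : Fin n) : k ≤ -1 := by
  obtain ⟨m, rfl⟩ := Nat.exists_eq_succ_of_ne_zero (NeZero.ne n)
  have : (-1 : Fin (m + 1)) = Fin.last m := by
    rw [eq_comm, eq_neg_iff_add_eq_zero, Fin.last_add_one]
  rw [this]
  exact Fin.le_last k

/-- Each vertex other than the root `b (-1)` has exactly one earliest visit. -/
theorem card_firstVisits [Fintype B] (hb : Function.Surjective b) :
    (firstVisits b).card = Fintype.card B - 1 := by
  rw [← Finset.card_univ, ← Finset.card_erase_of_mem (Finset.mem_univ (b (-1)))]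
  refine Finset.card_bij (fun k _ => b k) (fun k hk => ?_) (fun k hk l hl h => ?_) (fun W hW => ?_)
  · simpa using ((mem_firstVisits b).1 hk).1
  · rcases lt_trichotomy k l with hkl | hkl | hkl
    · exact absurd h (((mem_firstVisits b).1 hl).2 k hkl)
    · exact hkl
    · exact absurd h.symm (((mem_firstVisits b).1 hk).2 l hkl)
  · have hne : (Finset.univ.filter fun k => b k = W).Nonempty := by
      obtain ⟨k, hk⟩ := hb W
      exact ⟨k, by simp [hk]⟩
    have hmin := Finset.min'_mem _ hne
    simp only [Finset.mem_filter, Finset.mem_univ, true_and] at hmin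
    refine ⟨_, (mem_firstVisits b).2 ⟨?_, fun l hl hlW => ?_⟩, hmin⟩
    · rw [hmin]
      simpa using hW
    · exact absurd (Finset.min'_le (Finset.univ.filter fun k => b k = W) l
        (by simp [hlW, hmin])) (not_le.2 hl)

section Divergence

variable {R : Type*} [AddCommGroup R]

theorem flowDivergence_add (i j : Fin n → R) (W : B) :
    flowDivergence b (i + j) W = flowDivergence b i W + flowDivergence b j W := by
  simp only [flowDivergence, ← Finset.sum_add_distrib, Pi.add_apply]
  exact Finset.sum_congr rfl fun _ _ => by abel

theorem flowDivergence_neg (i : Fin n → R) (W : B) :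
    flowDivergence b (-i) W = -flowDivergence b i W := by
  simp only [flowDivergence, ← Finset.sum_neg_distrib, Pi.neg_apply]
  exact Finset.sum_congr rfl fun _ _ => by abel

theorem flowDivergence_sub (i j : Fin n → R) (W : B) :
    flowDivergence b (i - j) W = flowDivergence b i W - flowDivergence b j W := by
  rw [sub_eq_add_neg, flowDivergence_add, flowDivergence_neg, sub_eq_add_neg]

theorem flowDivergence_const (c : R) (W : B) : flowDivergence b (fun _ => c) W = 0 := by
  simp [flowDivergence]

theorem flowDivergence_add_const (i : Fin n → R) (c : R) (W : B) :
    flowDivergence b (fun k => i k + c) W = flowDivergence b i W := by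
  simp [flowDivergence]

theorem flowDivergence_zsmul (c : ℤ) (i : Fin n → R) (W : B) :
    flowDivergence b (c • i) W = c • flowDivergence b i W := by
  simp only [flowDivergence, Finset.smul_sum, smul_sub, Pi.smul_apply]

theorem flowDivergence_sum {ι : Type*} (s : Finset ι) (i : ι → Fin n → R) (W : B) :
    flowDivergence b (∑ a ∈ s, i a) W = ∑ a ∈ s, flowDivergence b (i a) W := by
  classical
  induction s using Finset.induction_on with
  | empty => simp [flowDivergence]
  | insert a s ha ih => rw [Finset.sum_insert ha, Finset.sum_insert ha, flowDivergence_add, ih]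

theorem sum_flowDivergence [Fintype B] (i : Fin n → R) : ∑ W, flowDivergence b i W = 0 := by
  simp only [flowDivergence]
  rw [Finset.sum_fiberwise, Finset.sum_sub_distrib, sub_eq_zero]
  exact Equiv.sum_comp (Equiv.addRight (1 : Fin n)) i

/-- A circulation is determined by its values off the spanning tree. -/
theorem eq_zero_of_flowDivergence_eq_zero {d : Fin n → R} (hd : ∀ W, flowDivergence b d W = 0)
    (h : ∀ k ∉ firstVisits b, d k = 0) (k : Fin n) : d k = 0 := by
  induction k using WellFoundedGT.induction with
  | ind k ih =>
    by_cases hk : k ∈ firstVisits b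
    swap
    · exact h k hk
    obtain ⟨hroot, hfirst⟩ := (mem_firstVisits b).1 hk
    -- Downward induction: every other visit to `b k` comes after `k`, so conservation at `b k`
    -- expresses `d k` through later values, already known to vanish.
    have hsum := hd (b k)
    rw [flowDivergence, Finset.sum_eq_single_of_mem k (by simp)] at hsum
    · rw [ih (k + 1) (Fin.lt_add_one_of_ne_neg_one fun h => hroot (by rw [h]))] at hsum
      simpa using hsum
    · intro l hl hlk
      have hl : b l = b k := by simpa using hl
      have hkl : k < l := lt_of_le_of_ne (not_lt.1 fun h => hfirst l h hl) (Ne.symm hlk)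
      have hl1 : l < l + 1 := Fin.lt_add_one_of_ne_neg_one fun h => hroot (by rw [← hl, h])
      rw [ih l hkl, ih (l + 1) (hkl.trans hl1), sub_zero]

/-- The flow along the first steps of the walk, up to step `m`. -/
theorem flowDivergence_initial (m : Fin n) (W : B) :
    flowDivergence b (fun k => if k ≤ m then (1 : ℤ) else 0) W =
      (if b (-1) = W then 1 else 0) - if b m = W then 1 else 0 := by
  have key : ∀ k : Fin n, ((if k + 1 ≤ m then (1 : ℤ) else 0) - if k ≤ m then 1 else 0) =
      (if k = -1 then 1 else 0) - if k = m then 1 else 0 := by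
    intro k
    by_cases hk : k = -1
    · subst hk
      have : (-1 : Fin n) ≤ m ↔ -1 = m := ⟨fun h => le_antisymm h (Fin.le_neg_one m), fun h => h.le⟩
      simp [this]
    · have hlt := Fin.lt_add_one_of_ne_neg_one hk
      have h1 : k + 1 ≤ m ↔ k < m := ⟨hlt.trans_le, Fin.add_one_le_of_lt_of_neZero⟩
      rw [if_neg hk]
      rcases lt_trichotomy k m with h | h | h
      · simp [h1, h, h.le, h.ne]
      · simp [h, (h ▸ hlt).not_ge]
      · simp [h1, h.not_ge, h.not_gt, h.ne']
  simp only [flowDivergence, key]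
  rw [Finset.sum_sub_distrib]
  simp [Finset.sum_ite_eq']

end Divergence

/-- Every integral function off the spanning tree extends to an integral circulation. -/
theorem exists_circulation_extending (t : Fin n → ℤ) :
    ∃ d : Fin n → ℤ, (∀ W, flowDivergence b d W = 0) ∧ ∀ k ∉ firstVisits b, d k = t k := by
  -- Off the tree, step `m` returns to a vertex already seen. The segment of the walk since that
  -- earlier visit is a circulation with value 1 at `m` and 0 afterwards, so these circulations form
  -- a unitriangular system.
  have cycle : ∀ m ∉ firstVisits b, ∃ v : Fin n → ℤ, (∀ W, flowDivergence b v W = 0) ∧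
      v m = 1 ∧ ∀ k, m < k → v k = 0 := by
    intro m hm
    by_cases hroot : b m = b (-1)
    · refine ⟨fun k => if k ≤ m then 1 else 0, fun W => ?_, by simp, fun k hk => by simp [hk.not_ge]⟩
      rw [flowDivergence_initial, hroot, sub_self]
    · obtain ⟨l, hlm, hl⟩ : ∃ l < m, b l = b m := by
        by_contra! h
        exact hm ((mem_firstVisits b).2 ⟨hroot, h⟩)
      refine ⟨(fun k => if k ≤ m then 1 else 0) - (fun k => if k ≤ l then 1 else 0),
        fun W => ?_, by simp [hlm], 
        fun k hk => by simp [hk.not_ge, (hlm.trans hk).not_ge]⟩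
      rw [flowDivergence_sub, flowDivergence_initial, flowDivergence_initial, hl, sub_self]
  have main : ∀ m : ℕ, ∀ t : Fin n → ℤ, ∃ d : Fin n → ℤ, (∀ W, flowDivergence b d W = 0) ∧
      (∀ k ∉ firstVisits b, d k = if (k : ℕ) < m then t k else 0) := by
    intro m
    induction m with
    | zero => exact fun t => ⟨0, fun W => flowDivergence_const b 0 W, by simp⟩
    | succ m ih =>
      intro t
      by_cases hm : ∃ h : m < n, (⟨m, h⟩ : Fin n) ∉ firstVisits b
      · obtain ⟨h, hm⟩ := hm
        obtain ⟨v, hv, hv1, hv0⟩ := cycle _ hm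
        obtain ⟨d, hd, hdt⟩ := ih (t - t ⟨m, h⟩ • v)
        refine ⟨d + t ⟨m, h⟩ • v, fun W => ?_, fun k hk => ?_⟩
        · rw [flowDivergence_add, flowDivergence_zsmul, hd, hv, smul_zero, add_zero]
        · rw [Pi.add_apply, hdt k hk]
          rcases lt_trichotomy (k : ℕ) m with hkm | hkm | hkm
          · simp [hkm, hkm.trans (Nat.lt_succ_self m)]
          · have : k = ⟨m, h⟩ := Fin.ext hkm
            subst this
            simp [hv1]
          · have : v k = 0 := hv0 k hkm
            simp [this, hkm.not_gt, show ¬ (k : ℕ) < m + 1 by omega]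
      · obtain ⟨d, hd, hdt⟩ := ih t
        refine ⟨d, hd, fun k hk => ?_⟩
        have hkm : (k : ℕ) ≠ m := fun h => hm ⟨h ▸ k.2, by subst h; exact hk⟩
        rw [hdt k hk]
        have : (k : ℕ) < m ↔ (k : ℕ) < m + 1 := by omega
        simp [this]
  obtain ⟨d, hd, hdt⟩ := main n t
  exact ⟨d, hd, fun k hk => by simp [hdt k hk]⟩

/-- Every vertex weight of total `0` is the divergence of an integral flow. -/
theorem exists_flowDivergence_eq [Fintype B] (hb : Function.Surjective b) (s : B → ℤ)
    (hs : ∑ W, s W = 0) : ∃ i : Fin n → ℤ, ∀ W, flowDivergence b i W = s W := by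
  choose c hc using hb
  -- Send `s V` units between the root and `V` along the walk; the contributions at the root cancel
  -- because `s` has total 0.
  refine ⟨-∑ V, s V • fun k => if k ≤ c V then 1 else 0, fun W => ?_⟩
  rw [flowDivergence_neg, flowDivergence_sum]
  simp only [flowDivergence_zsmul, flowDivergence_initial, hc, smul_sub, Finset.sum_sub_distrib,
    ← Finset.sum_smul, hs, zero_smul, zero_sub, neg_neg]
  simp

end Walk

/-! ### Counting flows with prescribed divergence -/

section Counting

variable {n : ℕ} [NeZero n] {B : Type*} [DecidableEq B] [Fintype B] (b : Fin n → B)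

/-- The number of flows with values in `{0, …, N - 1}` and prescribed divergence. -/
def flowCount (s : B → ℤ) (N : ℕ) : ℕ :=
  Finset.card {i : Fin n → Fin N | ∀ W, flowDivergence b (fun k => ((i k : ℕ) : ℤ)) W = s W}

theorem card_compl_firstVisits (hb : Function.Surjective b) :
    Fintype.card {k // k ∉ firstVisits b} = n + 1 - Fintype.card B := by
  have h1 : 1 ≤ Fintype.card B := Fintype.card_pos_iff.2 ⟨b 0⟩
  have h2 : Fintype.card B ≤ n := by simpa using Fintype.card_le_of_surjective b hb
  rw [Fintype.card_subtype_compl, Fintype.card_coe, card_firstVisits b hb, Fintype.card_fin]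
  omega

open scoped Pointwise in
/-- The number of circulations with values in `{0, …, N - 1}` grows like a power of `N`. -/
theorem exists_tendsto_flowCount_zero (hb : Function.Surjective b) :
    ∃ V : ℝ, Tendsto (fun N : ℕ => (flowCount b 0 N : ℝ) / (N : ℝ) ^ (n + 1 - Fintype.card B))
      atTop (𝓝 V) := by
  classical
  -- `A f` is the fundamental circulation of the non-tree edge `f`. These circulations form an
  -- integral basis, with the values off the tree as coordinates.
  have hA : ∀ f : {k // k ∉ firstVisits b}, ∃ d : Fin n → ℤ, (∀ W, flowDivergence b d W = 0) ∧
      ∀ k ∉ firstVisits b, d k = (Pi.single f.1 1 : Fin n → ℤ) k :=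
    fun f => exists_circulation_extending b _
  choose A hA0 hA1 using hA
  have hdiv : ∀ t : {k // k ∉ firstVisits b} → ℤ, ∀ W,
      flowDivergence b (fun e => ∑ f, t f * A f e) W = 0 := by
    intro t W
    have : (fun e => ∑ f, t f * A f e) = ∑ f, t f • A f := by
      ext e
      simp [Finset.sum_apply]
    rw [this, flowDivergence_sum]
    simp only [flowDivergence_zsmul, hA0, smul_zero, Finset.sum_const_zero]
  have hcoord : ∀ t : {k // k ∉ firstVisits b} → ℤ, ∀ k, ∀ hk : k ∉ firstVisits b,
      ∑ f, t f * A f k = t ⟨k, hk⟩ := by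
    intro t k hk
    rw [Finset.sum_eq_single ⟨k, hk⟩]
    · simp [hA1 _ k hk]
    · intro f _ hf
      have : k ≠ f.1 := fun h => hf (Subtype.ext h.symm)
      simp [hA1 f k hk, this]
    · simp
  have huniq : ∀ d : Fin n → ℤ, (∀ W, flowDivergence b d W = 0) →
      ∀ e, ∑ f : {k // k ∉ firstVisits b}, d f * A f e = d e := by
    intro d hd e
    refine sub_eq_zero.1 (eq_zero_of_flowDivergence_eq_zero b
      (d := (fun e => ∑ f : {k // k ∉ firstVisits b}, d f * A f e) - d) (fun W => ?_)
      (fun k hk => ?_) e)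
    · rw [flowDivergence_sub, hdiv (fun f => d f), hd, sub_zero]
    · simp [hcoord (fun f => d f) k hk]
  -- In tree-complement coordinates, the real circulations with all values in `[0, 1)`.
  set S : Set ({k // k ∉ firstVisits b} → ℝ) :=
    {t | ∀ e, ∑ f, t f * (A f e : ℝ) ∈ Set.Ico (0 : ℝ) 1} with hS
  have hcoordR : ∀ t : {k // k ∉ firstVisits b} → ℝ, ∀ k : {k // k ∉ firstVisits b},
      ∑ f, t f * (A f k : ℝ) = t k := by
    intro t k
    rw [Finset.sum_eq_single k]
    · simp [hA1 _ k.1 k.2]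
    · intro f _ hf
      have : k.1 ≠ f.1 := fun h => hf (Subtype.ext h.symm)
      simp [hA1 f k.1 k.2, this]
    · simp
  have hSb : Bornology.IsBounded S := by
    refine (Metric.isBounded_Icc (0 : {k // k ∉ firstVisits b} → ℝ) 1).subset fun t ht => ?_
    refine ⟨fun k => ?_, fun k => ?_⟩
    · simpa [hcoordR] using (ht k.1).1
    · simpa [hcoordR] using (ht k.1).2.le
  have hSm : MeasurableSet S := by
    rw [hS, Set.ofPred_forall]
    refine MeasurableSet.iInter fun e => ?_
    exact measurableSet_Ico.preimage (by fun_prop)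
  have hSc : Convex ℝ S := by
    rw [hS, Set.ofPred_forall]
    refine convex_iInter fun e => ?_
    have hlin : IsLinearMap ℝ fun t : {k // k ∉ firstVisits b} → ℝ => ∑ f, t f * (A f e : ℝ) :=
      { map_add := fun x y => by simp [add_mul, Finset.sum_add_distrib]
        map_smul := fun c x => by simp [Finset.mul_sum, mul_assoc] }
    exact (convex_Ico (0 : ℝ) 1).is_linear_preimage hlin
  -- Convexity makes the boundary null, which the lattice point asymptotics need.
  have hlim := tendsto_card_div_pow_atTop_volume S hSb hSm (hSc.addHaar_frontier volume)
  rw [card_compl_firstVisits b hb] at hlim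
  refine ⟨_, hlim.congr' ?_⟩
  filter_upwards [eventually_gt_atTop 0] with N hN
  congr 2
  have hN' : (0 : ℝ) < N := by exact_mod_cast hN
  set X : Finset (Fin n → Fin N) :=
    {i | ∀ W, flowDivergence b (fun k => ((i k : ℕ) : ℤ)) W = (0 : B → ℤ) W} with hX
  -- Dividing by `N` identifies the circulations being counted with the points of `S` in the lattice
  -- of mesh `1/N`.
  have himg : S ∩ (N : ℝ)⁻¹ • (Submodule.span ℤ (Set.range (Pi.basisFun ℝ
      {k // k ∉ firstVisits b})) : Set ({k // k ∉ firstVisits b} → ℝ)) =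
      (fun (i : Fin n → Fin N) (f : {k // k ∉ firstVisits b}) => (N : ℝ)⁻¹ * ((i f : ℕ) : ℝ)) ''
        (X : Set (Fin n → Fin N)) := by
    ext t
    constructor
    · rintro ⟨htS, z, hz, rfl⟩
      have hz' : ∀ f, ∃ m : ℤ, (m : ℝ) = z f := by
        have := (Module.Basis.mem_span_iff_repr_mem ℤ (Pi.basisFun ℝ _) z).1 hz
        simpa using this
      choose m hm using hz'
      have hmem : ∀ e, 0 ≤ ∑ f, m f * A f e ∧ ∑ f, m f * A f e < N := by
        intro e
        have h := htS e
        have heq : ∑ f, ((N : ℝ)⁻¹ • z) f * (A f e : ℝ) =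
            (N : ℝ)⁻¹ * ((∑ f, m f * A f e : ℤ) : ℝ) := by
          push_cast
          rw [Finset.mul_sum]
          refine Finset.sum_congr rfl fun f _ => ?_
          simp [hm, mul_assoc]
        have h' : (N : ℝ)⁻¹ * ((∑ f, m f * A f e : ℤ) : ℝ) ∈ Set.Ico (0 : ℝ) 1 := heq ▸ h
        rw [Set.mem_Ico, ← div_eq_inv_mul, div_lt_one hN'] at h'
        refine ⟨?_, by exact_mod_cast h'.2⟩
        have := mul_nonneg h'.1 hN'.le
        rw [div_mul_cancel₀ _ hN'.ne'] at this
        exact_mod_cast this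
      refine ⟨fun e => ⟨(∑ f, m f * A f e).toNat, by have := hmem e; omega⟩, ?_, ?_⟩
      · simp only [hX, Finset.coe_filter, Finset.mem_univ, true_and, Set.mem_ofPred_eq,
          Pi.zero_apply]
        intro W
        simp only [Int.toNat_of_nonneg (hmem _).1]
        exact hdiv m W
      · ext f
        have h1 : (((∑ g, m g * A g f).toNat : ℕ) : ℝ) = ((∑ g, m g * A g f : ℤ) : ℝ) := by
          exact_mod_cast Int.toNat_of_nonneg (hmem f).1
        rw [hcoord m f.1 f.2] at h1
        simp only [hcoord m f.1 f.2, Pi.smul_apply, smul_eq_mul]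
        rw [h1, hm]
    · rintro ⟨i, hi, rfl⟩
      simp only [hX, Finset.coe_filter, Finset.mem_univ, true_and, Set.mem_ofPred_eq,
          Pi.zero_apply] at hi
      refine ⟨fun e => ?_, fun f => ((i f : ℕ) : ℝ), ?_, rfl⟩
      · have h := huniq _ hi e
        have h' : ∑ f : {k // k ∉ firstVisits b}, (N : ℝ)⁻¹ * ((i f : ℕ) : ℝ) * (A f e : ℝ) =
            (i e : ℕ) / N := by
          rw [div_eq_inv_mul, ← Int.cast_natCast (i e : ℕ), ← h]
          push_cast
          rw [Finset.mul_sum]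
          exact Finset.sum_congr rfl fun f _ => by ring
        rw [h']
        refine ⟨by positivity, (div_lt_one hN').2 (by exact_mod_cast (i e).2)⟩
      · refine (Module.Basis.mem_span_iff_repr_mem ℤ (Pi.basisFun ℝ _) _).2 fun f => ?_
        exact ⟨((i f : ℕ) : ℤ), by simp⟩
  rw [himg, Nat.card_coe_set_eq, Set.InjOn.ncard_image, Set.ncard_coe_finset, flowCount]
  intro i hi j hj hij
  simp only [hX, Finset.coe_filter, Finset.mem_univ, true_and, Set.mem_ofPred_eq,
          Pi.zero_apply] at hi hj
  ext e
  have h1 := huniq _ hi e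
  have h2 := huniq _ hj e
  have h3 : ∀ f : {k // k ∉ firstVisits b}, (i f : ℕ) = (j f : ℕ) := by
    intro f
    have := congrFun hij f
    have := mul_left_cancel₀ (inv_ne_zero hN'.ne') this
    exact_mod_cast this
  simp only [h3] at h1
  exact_mod_cast h1.symm.trans h2

/-- Translation by a flow `d` and a constant embeds a set of flows in another one. -/
theorem flowCount_le_flowCount_add (s : B → ℤ) (d : Fin n → ℤ) (C : ℕ)
    (hC : ∀ k, |d k| ≤ C) (N : ℕ) :
    flowCount b s N ≤ flowCount b (fun W => s W + flowDivergence b d W) (N + 2 * C) := by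
  have hb : ∀ (i : Fin N) (k : Fin n), 0 ≤ ((i : ℕ) : ℤ) + d k + C ∧
      ((i : ℕ) : ℤ) + d k + C < N + 2 * C := by
    intro i k
    have := abs_le.1 (hC k)
    have := i.2
    omega
  refine Finset.card_le_card_of_injOn
    (fun i k => ⟨(((i k : ℕ) : ℤ) + d k + C).toNat, by have := hb (i k) k; omega⟩)
    (fun i hi => ?_) (fun i _ j _ hij => ?_)
  · simp only [Finset.coe_filter, Finset.mem_univ, true_and, Set.mem_ofPred_eq] at hi ⊢
    intro W
    simp only [Int.toNat_of_nonneg (hb _ _).1]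
    rw [flowDivergence_add_const, ← hi W, ← flowDivergence_add]
    rfl
  · ext k
    have := congrArg Fin.val (congrFun hij k)
    simp only at this
    have h1 := hb (i k) k
    have h2 := hb (j k) k
    omega

theorem tendsto_add_mul_pow_ratio (C d : ℕ) :
    Tendsto (fun N : ℕ => (((N + C : ℕ) : ℝ) / N) ^ d) atTop (𝓝 1) := by
  have h : Tendsto (fun N : ℕ => 1 + (C : ℝ) / N) atTop (𝓝 (1 + 0)) :=
    tendsto_const_nhds.add (tendsto_const_div_atTop_nhds_zero_nat _)
  have h2 := (h.pow d)
  rw [add_zero, one_pow] at h2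
  refine h2.congr' ?_
  filter_upwards [eventually_gt_atTop 0] with N hN
  have : (N : ℝ) ≠ 0 := by positivity
  push_cast
  field_simp

/-- The asymptotic number of flows does not depend on the prescribed divergence. -/
theorem tendsto_flowCount (hb : Function.Surjective b) {V : ℝ}
    (hV : Tendsto (fun N : ℕ => (flowCount b 0 N : ℝ) / (N : ℝ) ^ (n + 1 - Fintype.card B))
      atTop (𝓝 V)) (s : B → ℤ) (hs : ∑ W, s W = 0) :
    Tendsto (fun N : ℕ => (flowCount b s N : ℝ) / (N : ℝ) ^ (n + 1 - Fintype.card B))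
      atTop (𝓝 V) := by
  obtain ⟨d, hd⟩ := exists_flowDivergence_eq b hb s hs
  obtain ⟨C, hC⟩ : ∃ C : ℕ, ∀ k, |d k| ≤ C :=
    ⟨∑ k, (d k).natAbs, fun k => by
      rw [Int.abs_eq_natAbs]
      exact_mod_cast Finset.single_le_sum (f := fun k => (d k).natAbs) (fun _ _ => Nat.zero_le _)
        (Finset.mem_univ k)⟩
  set D := n + 1 - Fintype.card B
  have hup : ∀ N, flowCount b s N ≤ flowCount b 0 (N + 2 * C) := by
    intro N
    have h := flowCount_le_flowCount_add b s (-d) C (by simpa using hC) N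
    have h0 : (fun W => s W + flowDivergence b (-d) W) = 0 := by
      ext W
      simp [flowDivergence_neg, hd]
    rwa [h0] at h
  have hlow : ∀ N, flowCount b 0 N ≤ flowCount b s (N + 2 * C) := by
    intro N
    have h := flowCount_le_flowCount_add b 0 d C hC N
    have h0 : (fun W => (0 : B → ℤ) W + flowDivergence b d W) = s := by
      ext W
      simp [hd]
    rwa [h0] at h
  have hshift : ∀ᶠ N : ℕ in atTop, 0 < N := eventually_gt_atTop 0
  have hratio := tendsto_add_mul_pow_ratio (2 * C) D
  -- After this shift, the count for `s` at `N + 2C` lies between the counts for 0 at `N` and at `N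
  -- + 4C`.
  rw [← tendsto_add_atTop_iff_nat (2 * C)]
  have hup' := ((tendsto_add_atTop_iff_nat (2 * C)).2
    ((tendsto_add_atTop_iff_nat (2 * C)).2 hV)).mul
    ((tendsto_add_atTop_iff_nat (2 * C)).2 hratio)
  have hlow' := hV.div hratio one_ne_zero
  rw [mul_one] at hup'
  rw [div_one] at hlow'
  refine tendsto_of_tendsto_of_tendsto_of_le_of_le' hlow' hup' ?_ ?_
  · filter_upwards [hshift] with N hN
    have h1 : (0 : ℝ) < N := by exact_mod_cast hN
    have h2 : (0 : ℝ) < ((N + 2 * C : ℕ) : ℝ) := by positivity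
    have h3 : (flowCount b 0 N : ℝ) ≤ flowCount b s (N + 2 * C) := by exact_mod_cast hlow N
    simp only [Pi.div_apply]
    rw [div_pow, div_div_div_cancel_right₀ (by positivity)]
    gcongr
  · filter_upwards [hshift] with N hN
    have h1 : (0 : ℝ) < N := by exact_mod_cast hN
    have h2 : (0 : ℝ) < ((N + 2 * C : ℕ) : ℝ) := by positivity
    have h4 : (0 : ℝ) < ((N + 2 * C + 2 * C : ℕ) : ℝ) := by positivity
    have h3 : (flowCount b s (N + 2 * C) : ℝ) ≤ flowCount b 0 (N + 2 * C + 2 * C) := by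
      exact_mod_cast hup (N + 2 * C)
    rw [div_pow, div_mul_div_cancel₀ (by positivity)]
    gcongr

theorem flowCount_eq_zero (s : B → ℤ) (hs : ∑ W, s W ≠ 0) (N : ℕ) : flowCount b s N = 0 := by
  rw [flowCount, Finset.card_eq_zero, Finset.filter_eq_empty_iff]
  intro i _ h
  apply hs
  rw [← sum_flowDivergence b (fun k => ((i k : ℕ) : ℤ))]
  exact Finset.sum_congr rfl fun W _ => (h W).symm

end Counting

/-! ### The kernel on the circle and its size -/

instance fact_two_pi_pos : Fact (0 < 2 * Real.pi) := ⟨Real.two_pi_pos⟩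

/-- The trigonometric polynomial `∑_{0 ≤ i < N} e^{jiθ}` on the circle `ℝ / 2πℤ`. -/
noncomputable def circleKernel (N : ℕ) (t : AddCircle (2 * Real.pi)) : ℂ :=
  ∑ i : Fin N, fourier ((i : ℕ) : ℤ) t

theorem continuous_circleKernel (N : ℕ) : Continuous (circleKernel N) := by
  unfold circleKernel
  exact continuous_finsetSum _ fun i _ => (fourier _).continuous

theorem fourier_two_pi_coe (m : ℤ) (x : ℝ) :
    fourier m (x : AddCircle (2 * Real.pi)) = Complex.exp (Complex.I * x) ^ m := by
  rw [fourier_coe_apply, ← Complex.exp_int_mul]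
  congr 1
  have : (Real.pi : ℂ) ≠ 0 := by exact_mod_cast Real.pi_ne_zero
  push_cast
  field_simp

theorem circleKernel_coe (N : ℕ) (x : ℝ) :
    circleKernel N (x : AddCircle (2 * Real.pi)) = vandermondeKernel N x := by
  rw [vandermondeKernel_eq_sum, circleKernel, Finset.sum_range]
  exact Finset.sum_congr rfl fun i _ => by rw [fourier_two_pi_coe, zpow_natCast]

theorem norm_circleKernel_le (N : ℕ) (t : AddCircle (2 * Real.pi)) : ‖circleKernel N t‖ ≤ N := by
  refine (norm_sum_le _ _).trans ?_
  simp [Circle.norm_coe]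

/-- The geometric sum times `1 - e^{jx}` has modulus at most 2, while `|1 - e^{jx}| = 2|sin(x/2)| ≥
2|x|/π` on this range. -/
theorem norm_circleKernel_mul_abs_le (N : ℕ) {x : ℝ} (hx : |x| ≤ Real.pi) :
    ‖circleKernel N (x : AddCircle (2 * Real.pi))‖ * |x| ≤ Real.pi := by
  have hz : ‖Complex.exp (Complex.I * x)‖ = 1 := by
    rw [mul_comm]; exact Complex.norm_exp_ofReal_mul_I x
  have hgeom : circleKernel N (x : AddCircle (2 * Real.pi)) * (1 - Complex.exp (Complex.I * x)) =
      1 - Complex.exp (Complex.I * x) ^ N := by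
    rw [circleKernel_coe, vandermondeKernel_eq_sum, geom_sum_mul_neg]
  have h2 : ‖circleKernel N (x : AddCircle (2 * Real.pi))‖ *
      ‖1 - Complex.exp (Complex.I * x)‖ ≤ 2 := by
    rw [← norm_mul, hgeom]
    refine (norm_sub_le _ _).trans ?_
    rw [norm_pow, hz]
    norm_num
  have h3 : 2 / Real.pi * |x| ≤ ‖1 - Complex.exp (Complex.I * x)‖ := by
    rw [norm_sub_rev, Complex.norm_exp_I_mul_ofReal_sub_one, Real.norm_eq_abs, abs_mul]
    have h := Real.mul_abs_le_abs_sin (x := x / 2) (by rw [abs_div]; simpa using by gcongr)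
    rw [abs_div] at h
    simp only [abs_two] at h ⊢
    linarith
  have hpi := Real.pi_pos
  have h4 := (mul_le_mul_of_nonneg_left h3 (norm_nonneg
    (circleKernel N (x : AddCircle (2 * Real.pi))))).trans h2
  have h5 : ‖circleKernel N (x : AddCircle (2 * Real.pi))‖ * |x| =
      Real.pi / 2 * (‖circleKernel N (x : AddCircle (2 * Real.pi))‖ * (2 / Real.pi * |x|)) := by
    field_simp
  rw [h5]
  nlinarith

/-- The normalized modulus of the kernel. -/
noncomputable def kernelRatio (N : ℕ) (t : AddCircle (2 * Real.pi)) : ℝ := ‖circleKernel N t‖ / N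

theorem continuous_kernelRatio (N : ℕ) : Continuous (kernelRatio N) :=
  (continuous_circleKernel N).norm.div_const _

theorem kernelRatio_nonneg (N : ℕ) (t : AddCircle (2 * Real.pi)) : 0 ≤ kernelRatio N t := by
  unfold kernelRatio; positivity

theorem kernelRatio_le_one (N : ℕ) (t : AddCircle (2 * Real.pi)) : kernelRatio N t ≤ 1 :=
  div_le_one_of_le₀ (norm_circleKernel_le N t) (by positivity)

theorem kernelRatio_coe_le {N : ℕ} (hN : 0 < N) {x : ℝ} (hx : |x| ≤ Real.pi) :
    kernelRatio N (x : AddCircle (2 * Real.pi)) ≤ (1 + Real.pi) * (1 + ‖(N : ℝ) * x‖)⁻¹ := by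
  have hN' : (0 : ℝ) < N := by exact_mod_cast hN
  rw [← div_eq_mul_inv, le_div_iff₀ (by positivity), mul_add, mul_one]
  refine add_le_add (kernelRatio_le_one N _) ?_
  rw [Real.norm_eq_abs, abs_mul, Nat.abs_cast, kernelRatio, div_mul_eq_mul_div,
    mul_left_comm, mul_div_cancel_left₀ _ hN'.ne']
  exact norm_circleKernel_mul_abs_le N hx

/-- Substituting `y = N x` in the pointwise decay bound gains the factor `1/N`; `1 < a` is what
makes the majorant integrable on the whole line. -/
theorem exists_integral_kernelRatio_rpow_le {a : ℝ} (ha : 1 < a) :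
    ∃ C : ℝ, 0 ≤ C ∧ ∀ N : ℕ, 0 < N →
      ∫ t, kernelRatio N t ^ a ∂AddCircle.haarAddCircle ≤ C / N := by
  have hint : Integrable fun x : ℝ => (1 + ‖x‖) ^ (-a) :=
    integrable_one_add_norm (by simpa using ha)
  have ha0 : 0 ≤ a := by linarith
  set J : ℝ := ∫ x : ℝ, (1 + ‖x‖) ^ (-a) with hJ
  have hJ0 : 0 ≤ J := integral_nonneg fun x => by positivity
  refine ⟨(2 * Real.pi)⁻¹ * ((1 + Real.pi) ^ a * J), by positivity, fun N hN => ?_⟩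
  have hN' : (0 : ℝ) < N := by exact_mod_cast hN
  have hscale : Integrable fun x : ℝ => (1 + ‖(N : ℝ) * x‖) ^ (-a) :=
    hint.comp_mul_left' hN'.ne'
  -- The period is centred at 0, so that `|x| ≤ π` throughout.
  rw [AddCircle.integral_haarAddCircle, ← AddCircle.intervalIntegral_preimage _ (-Real.pi),
    smul_eq_mul, mul_div_assoc]
  gcongr
  have hle : -Real.pi ≤ -Real.pi + 2 * Real.pi := by linarith [Real.pi_pos]
  calc ∫ x in (-Real.pi)..(-Real.pi + 2 * Real.pi),
        kernelRatio N (x : AddCircle (2 * Real.pi)) ^ a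
      ≤ ∫ x in (-Real.pi)..(-Real.pi + 2 * Real.pi),
        (1 + Real.pi) ^ a * (1 + ‖(N : ℝ) * x‖) ^ (-a) := by
        refine intervalIntegral.integral_mono_on hle ?_ ?_ fun x hx => ?_
        · refine Continuous.intervalIntegrable ?_ _ _
          exact ((continuous_kernelRatio N).comp (AddCircle.continuous_mk' _)).rpow_const
            fun _ => Or.inr ha0
        · exact (hscale.const_mul _).intervalIntegrable
        · have hx' : |x| ≤ Real.pi := abs_le.2 ⟨hx.1, by linarith [hx.2]⟩
          rw [Real.rpow_neg (by positivity), ← Real.inv_rpow (by positivity),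
            ← Real.mul_rpow (by positivity) (by positivity)]
          exact Real.rpow_le_rpow (kernelRatio_nonneg _ _) (kernelRatio_coe_le hN hx') ha0
    _ ≤ ∫ x : ℝ, (1 + Real.pi) ^ a * (1 + ‖(N : ℝ) * x‖) ^ (-a) := by
        rw [intervalIntegral.integral_of_le hle]
        exact setIntegral_le_integral (hscale.const_mul _)
          (Eventually.of_forall fun x => by positivity)
    _ = (1 + Real.pi) ^ a * J / N := by
        rw [integral_const_mul, Measure.integral_comp_mul_left (fun x : ℝ => (1 + ‖x‖) ^ (-a)),
          abs_of_pos (by positivity), smul_eq_mul]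
        ring

/-- The normalized Haar measure on a power of the circle. -/
noncomputable abbrev torusMeasure (B : Type*) [Fintype B] :
    Measure (B → AddCircle (2 * Real.pi)) :=
  Measure.pi fun _ => AddCircle.haarAddCircle

/-! ### Tree coordinates and the uniform `L¹` bound -/

section Tree

variable {n : ℕ} [NeZero n] {B : Type*} [DecidableEq B] (b : Fin n → B)

/-- Coordinates on a power of the circle: the differences along the edges of the spanning tree
and one further coordinate. -/
def treeHom {G : Type*} [AddCommGroup G] (W : B) : (B → G) →+ (firstVisits b → G) × G where
  toFun x := (fun k => x (b (k - 1)) - x (b k), x W)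
  map_zero' := by ext <;> simp
  map_add' x y := by
    ext
    · simp only [Pi.add_apply, Prod.fst_add]; abel
    · rfl

/-- Vertex values can be chosen in order of first visit, each new one fixed by its tree edge; a
final translation adjusts the value at `W` without changing differences. -/
theorem surjective_treeHom {G : Type*} [AddCommGroup G] (W : B) :
    Function.Surjective (treeHom (G := G) b W) := by
  have main : ∀ (z : Fin n → G) (m : ℕ), ∃ x : B → G, ∀ k ∈ firstVisits b, (k : ℕ) < m →
      x (b (k - 1)) - x (b k) = z k := by
    intro z m
    induction m with
    | zero => exact ⟨0, by simp⟩
    | succ m ih =>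
      obtain ⟨x, hx⟩ := ih
      by_cases hm : ∃ h : m < n, (⟨m, h⟩ : Fin n) ∈ firstVisits b
      · obtain ⟨h, hm⟩ := hm
        obtain ⟨hroot, hfirst⟩ := (mem_firstVisits b).1 hm
        have hpred : ∀ k : Fin n, (k : ℕ) ≤ m → b (k - 1) ≠ b ⟨m, h⟩ := by
          intro k hk
          by_cases h1 : k - 1 = -1
          · rw [h1]
            exact hroot.symm
          · have := Fin.lt_add_one_of_ne_neg_one h1
            rw [sub_add_cancel] at this
            exact hfirst _ (this.trans_le hk)
        refine ⟨Function.update x (b ⟨m, h⟩) (x (b (⟨m, h⟩ - 1)) - z ⟨m, h⟩), fun k hk hkm => ?_⟩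
        rw [Function.update_of_ne (hpred k (by omega))]
        rcases Nat.lt_succ_iff_lt_or_eq.1 hkm with hlt | heq
        · rw [Function.update_of_ne (hfirst k hlt)]
          exact hx k hk hlt
        · obtain rfl : k = ⟨m, h⟩ := Fin.ext heq
          simp
      · refine ⟨x, fun k hk hkm => hx k hk ?_⟩
        have : (k : ℕ) ≠ m := fun h => hm ⟨h ▸ k.2, by subst h; exact hk⟩
        omega
  rintro ⟨z, w⟩
  obtain ⟨x, hx⟩ := main (fun k => if h : k ∈ firstVisits b then z ⟨k, h⟩ else 0) n
  refine ⟨fun V => x V + (w - x W), Prod.ext (funext fun k => ?_) ?_⟩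
  · have := hx k k.2 k.1.2
    simpa [treeHom] using this
  · simp [treeHom]

/-- A product over the edges of a closed walk is bounded by products over spanning trees: the
smallest factor is missing from some tree, and is distributed evenly among its edges. -/
theorem prod_le_sum_prod_tree (φ : Fin n → ℝ) (h0 : ∀ k, 0 ≤ φ k) (h1 : ∀ k, φ k ≤ 1) :
    ∏ k, φ k ≤ ∑ c : Fin n, ∏ k ∈ firstVisits (fun k => b (k + c)),
      φ (k + c) ^ (1 + (n : ℝ)⁻¹) := by
  obtain ⟨e, he⟩ := Finite.exists_min φ
  have hn : (n : ℝ) ≠ 0 := by exact_mod_cast NeZero.ne n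
  have hninv : (0 : ℝ) ≤ (n : ℝ)⁻¹ := by positivity
  -- Rotating by `e + 1` makes `e` the last step of the walk. That step ends at the root, so it is
  -- never a first visit and the tree avoids `e`.
  set S := (firstVisits (fun k => b (k + (e + 1)))).map (Equiv.addRight (e + 1)).toEmbedding with hS
  have heS : e ∉ S := by
    rw [hS, Finset.mem_map]
    rintro ⟨k, hk, hke⟩
    have hk1 : k = -1 := by
      have : k + (e + 1) = e := hke
      rw [eq_neg_iff_add_eq_zero]
      have h2 : (k + 1) + e = 0 + e := by
        rw [zero_add, add_assoc, add_comm 1 e]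
        exact this
      exact add_right_cancel h2
    exact ((mem_firstVisits _).1 hk).1 (by rw [hk1])
  calc ∏ k, φ k ≤ ∏ k ∈ insert e S, φ k := by
        rw [← Finset.prod_sdiff (Finset.subset_univ (insert e S))]
        exact mul_le_of_le_one_left (Finset.prod_nonneg fun k _ => h0 k)
          (Finset.prod_le_one (fun k _ => h0 k) fun k _ => h1 k)
    _ = φ e * ∏ k ∈ S, φ k := Finset.prod_insert heS
    _ ≤ (∏ k ∈ S, φ k ^ (n : ℝ)⁻¹) * ∏ k ∈ S, φ k := by
        refine mul_le_mul_of_nonneg_right ?_ (Finset.prod_nonneg fun k _ => h0 k)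
        calc φ e = (φ e ^ (n : ℝ)⁻¹) ^ n := by
              rw [← Real.rpow_natCast, ← Real.rpow_mul (h0 e), inv_mul_cancel₀ hn, Real.rpow_one]
          _ ≤ (φ e ^ (n : ℝ)⁻¹) ^ S.card :=
              pow_le_pow_of_le_one (Real.rpow_nonneg (h0 e) _)
                (Real.rpow_le_one (h0 e) (h1 e) hninv) (by simpa using S.card_le_univ)
          _ = ∏ k ∈ S, φ e ^ (n : ℝ)⁻¹ := by rw [Finset.prod_const]
          _ ≤ ∏ k ∈ S, φ k ^ (n : ℝ)⁻¹ :=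
              Finset.prod_le_prod (fun k _ => Real.rpow_nonneg (h0 e) _)
                fun k _ => Real.rpow_le_rpow (h0 e) (he k) hninv
    _ = ∏ k ∈ S, φ k ^ (1 + (n : ℝ)⁻¹) := by
        rw [← Finset.prod_mul_distrib]
        refine Finset.prod_congr rfl fun k _ => ?_
        rw [Real.rpow_add_of_nonneg (h0 k) zero_le_one hninv, Real.rpow_one, mul_comm]
    _ = ∏ k ∈ firstVisits (fun k => b (k + (e + 1))), φ (k + (e + 1)) ^ (1 + (n : ℝ)⁻¹) := by
        rw [hS, Finset.prod_map]
        rfl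
    _ ≤ _ := Finset.single_le_sum (f := fun c : Fin n =>
          ∏ k ∈ firstVisits (fun k => b (k + c)), φ (k + c) ^ (1 + (n : ℝ)⁻¹))
          (fun c _ => Finset.prod_nonneg fun k _ => Real.rpow_nonneg (h0 _) _)
          (Finset.mem_univ (e + 1))

variable [Fintype B]

/-- A continuous surjective homomorphism of compact groups carries normalized Haar measure to
normalized Haar measure. Tree differences and one vertex value are therefore independent and
uniform. -/
theorem measurePreserving_treeHom (W : B) :
    MeasurePreserving (treeHom (G := AddCircle (2 * Real.pi)) b W) (torusMeasure B)
      ((torusMeasure (firstVisits b)).prod AddCircle.haarAddCircle) := by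
  have : Measure.IsAddHaarMeasure ((torusMeasure (firstVisits b)).prod
      (AddCircle.haarAddCircle (T := 2 * Real.pi))) := Measure.prod.instIsAddHaarMeasure _ _
  refine AddMonoidHom.measurePreserving ?_ (surjective_treeHom b W) ?_
  · refine Continuous.prodMk ?_ (continuous_apply W)
    exact continuous_pi fun k => (continuous_apply _).sub (continuous_apply _)
  · simp

theorem integral_tree {h g : AddCircle (2 * Real.pi) → ℝ} (hh : Continuous h) (hg : Measurable g)
    (W : B) :
    ∫ x, (∏ k ∈ firstVisits b, h (x (b (k - 1)) - x (b k))) * g (x W) ∂torusMeasure B =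
      (∫ t, h t ∂AddCircle.haarAddCircle) ^ (firstVisits b).card *
        ∫ t, g t ∂AddCircle.haarAddCircle := by
  have hmp := measurePreserving_treeHom b W
  have hmeas : Measurable fun z : (firstVisits b → AddCircle (2 * Real.pi)) ×
      AddCircle (2 * Real.pi) => (∏ k, h (z.1 k)) * g z.2 := by
    have := hh.measurable
    fun_prop
  calc _ = ∫ x, (fun z : (firstVisits b → AddCircle (2 * Real.pi)) × AddCircle (2 * Real.pi) =>
          (∏ k, h (z.1 k)) * g z.2) (treeHom b W x) ∂torusMeasure B := by
        refine integral_congr_ae (Eventually.of_forall fun x => ?_)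
        simp only [treeHom, AddMonoidHom.coe_mk, ZeroHom.coe_mk]
        rw [Finset.prod_coe_sort (firstVisits b) fun k => h (x (b (k - 1)) - x (b k))]
    _ = ∫ z, (∏ k, h (z.1 k)) * g z.2
          ∂(torusMeasure (firstVisits b)).prod AddCircle.haarAddCircle := by
        rw [← hmp.map_eq, integral_map hmp.measurable.aemeasurable hmeas.aestronglyMeasurable]
    _ = _ := by
        rw [integral_prod_mul (fun z : firstVisits b → AddCircle (2 * Real.pi) => ∏ k, h (z k)) g,
          integral_fintype_prod_eq_prod (fun (_ : firstVisits b) t => h t)]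
        simp

/-- The normalized kernel is bounded in `L¹`, uniformly in `N`. -/
theorem exists_integral_prod_kernelRatio_le (hb : Function.Surjective b) :
    ∃ C : ℝ, 0 ≤ C ∧ ∀ N : ℕ, 0 < N → ∀ (W : B) (g : AddCircle (2 * Real.pi) → ℝ) (M : ℝ),
      Measurable g → (∀ t, 0 ≤ g t) → (∀ t, g t ≤ M) →
      (N : ℝ) ^ (Fintype.card B - 1) *
        ∫ x, (∏ k, kernelRatio N (x (b (k - 1)) - x (b k))) * g (x W) ∂torusMeasure B ≤
        C * ∫ t, g t ∂AddCircle.haarAddCircle := by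
  have hn : (0 : ℝ) < n := by exact_mod_cast NeZero.pos n
  have ha : 1 < 1 + (n : ℝ)⁻¹ := by simpa using hn
  obtain ⟨C, hC, hCN⟩ := exists_integral_kernelRatio_rpow_le ha
  set r := Fintype.card B - 1
  refine ⟨n * C ^ r, by positivity, fun N hN W g M hg hg0 hgM => ?_⟩
  have hN' : (0 : ℝ) < N := by exact_mod_cast hN
  set h : AddCircle (2 * Real.pi) → ℝ := fun t => kernelRatio N t ^ (1 + (n : ℝ)⁻¹) with hh
  have hhc : Continuous h := (continuous_kernelRatio N).rpow_const fun _ => Or.inr (by positivity)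
  have hh0 : ∀ t, 0 ≤ h t := fun t => Real.rpow_nonneg (kernelRatio_nonneg N t) _
  have hh1 : ∀ t, h t ≤ 1 := fun t =>
    Real.rpow_le_one (kernelRatio_nonneg N t) (kernelRatio_le_one N t) (by positivity)
  have hint : ∀ (s : Finset (Fin n)) (u v : Fin n → B) (k : AddCircle (2 * Real.pi) → ℝ),
      Continuous k → (∀ t, 0 ≤ k t) → (∀ t, k t ≤ 1) →
      Integrable (fun x : B → AddCircle (2 * Real.pi) =>
        (∏ e ∈ s, k (x (u e) - x (v e))) * g (x W)) (torusMeasure B) := by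
    intro s u v k hk hk0 hk1
    refine Integrable.of_bound (C := M) ?_ (Eventually.of_forall fun x => ?_)
    · have := hk.measurable
      exact (Measurable.aestronglyMeasurable (by fun_prop))
    · rw [Real.norm_of_nonneg (mul_nonneg (Finset.prod_nonneg fun _ _ => hk0 _) (hg0 _))]
      exact (mul_le_of_le_one_left (hg0 _)
        (Finset.prod_le_one (fun _ _ => hk0 _) fun _ _ => hk1 _)).trans (hgM _)
  have hI0 : 0 ≤ ∫ t, g t ∂AddCircle.haarAddCircle := integral_nonneg hg0
  -- Each of the `r` tree edges contributes a factor `C / N`, which cancels `N ^ r`.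
  have htree : ∀ c : Fin n, ∫ x, (∏ k ∈ firstVisits (fun k => b (k + c)),
      h (x (b (k + c - 1)) - x (b (k + c)))) * g (x W) ∂torusMeasure B ≤
      (C / N) ^ r * ∫ t, g t ∂AddCircle.haarAddCircle := by
    intro c
    have hsurj : Function.Surjective fun k => b (k + c) :=
      hb.comp (Equiv.addRight c).surjective
    have key := integral_tree (fun k => b (k + c)) hhc hg W
    rw [card_firstVisits _ hsurj] at key
    simp only [show ∀ k : Fin n, k - 1 + c = k + c - 1 from fun k => by abel] at key
    rw [key]
    gcongr
    · exact integral_nonneg hh0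
    · exact hCN N hN
  calc (N : ℝ) ^ r *
        ∫ x, (∏ k, kernelRatio N (x (b (k - 1)) - x (b k))) * g (x W) ∂torusMeasure B
      ≤ (N : ℝ) ^ r * ∫ x, ∑ c : Fin n, (∏ k ∈ firstVisits (fun k => b (k + c)),
          h (x (b (k + c - 1)) - x (b (k + c)))) * g (x W) ∂torusMeasure B := by
        refine mul_le_mul_of_nonneg_left (integral_mono ?_ ?_ fun x => ?_) (by positivity)
        · exact hint Finset.univ (fun k => b (k - 1)) b _ (continuous_kernelRatio N)
            (kernelRatio_nonneg N) (kernelRatio_le_one N)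
        · exact integrable_finsetSum _ fun c _ =>
            hint _ (fun k => b (k + c - 1)) (fun k => b (k + c)) h hhc hh0 hh1
        · simp only
          rw [← Finset.sum_mul]
          exact mul_le_mul_of_nonneg_right (prod_le_sum_prod_tree b
            (fun k => kernelRatio N (x (b (k - 1)) - x (b k))) (fun _ => kernelRatio_nonneg N _)
            fun _ => kernelRatio_le_one N _) (hg0 _)
    _ = (N : ℝ) ^ r * ∑ c : Fin n, ∫ x, (∏ k ∈ firstVisits (fun k => b (k + c)),
          h (x (b (k + c - 1)) - x (b (k + c)))) * g (x W) ∂torusMeasure B := by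
        rw [integral_finsetSum _ fun c _ =>
          hint _ (fun k => b (k + c - 1)) (fun k => b (k + c)) h hhc hh0 hh1]
    _ ≤ (N : ℝ) ^ r * ∑ c : Fin n, (C / N) ^ r * ∫ t, g t ∂AddCircle.haarAddCircle := by
        gcongr with c
        exact htree c
    _ = n * C ^ r * ∫ t, g t ∂AddCircle.haarAddCircle := by
        rw [Finset.sum_const, Finset.card_univ, Fintype.card_fin, nsmul_eq_mul, div_pow]
        field_simp

end Tree

/-! ### Fourier analysis and trigonometric approximation -/

theorem fourier_sub_apply (m : ℤ) (s t : AddCircle (2 * Real.pi)) :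
    fourier m (s - t) = fourier m s * fourier (-m) t := by
  simp [sub_eq_add_neg, AddCircle.toCircle_add]

theorem fourier_sum {ι : Type*} (s : Finset ι) (m : ι → ℤ) (t : AddCircle (2 * Real.pi)) :
    fourier (∑ a ∈ s, m a) t = ∏ a ∈ s, fourier (m a) t := by
  classical
  induction s using Finset.induction_on with
  | empty => simp
  | insert a s ha ih => rw [Finset.sum_insert ha, Finset.prod_insert ha, fourier_add, ih]

theorem integral_fourier (m : ℤ) :
    ∫ t : AddCircle (2 * Real.pi), fourier m t ∂AddCircle.haarAddCircle =
      if m = 0 then 1 else 0 := by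
  have h := fourierCoeff_fourier (T := 2 * Real.pi) m
  have h0 := congrFun h 0
  simp only [fourierCoeff, neg_zero, fourier_zero, one_smul] at h0
  rw [h0, Pi.single_apply]
  simp [eq_comm]

/-- Replace the factors one at a time; `1 ≤ M` allows a uniform power of `M`. -/
theorem norm_prod_sub_prod_le {ι : Type*} (s : Finset ι) (u v : ι → ℂ) {M : ℝ} (hM : 1 ≤ M)
    (hu : ∀ a, ‖u a‖ ≤ M) (hv : ∀ a, ‖v a‖ ≤ M) :
    ‖∏ a ∈ s, u a - ∏ a ∈ s, v a‖ ≤ M ^ s.card * ∑ a ∈ s, ‖u a - v a‖ := by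
  classical
  have hM0 : 0 ≤ M := zero_le_one.trans hM
  induction s using Finset.induction_on with
  | empty => simp
  | insert a s ha ih =>
    rw [Finset.prod_insert ha, Finset.prod_insert ha, Finset.sum_insert ha,
      Finset.card_insert_of_notMem ha]
    have hvs : ‖∏ a ∈ s, v a‖ ≤ M ^ s.card := by
      rw [norm_prod]
      exact (Finset.prod_le_prod (fun _ _ => norm_nonneg _) fun a _ => hv a).trans (by simp)
    have hpow : M ^ s.card ≤ M ^ (s.card + 1) := pow_le_pow_right₀ hM (Nat.le_succ _)
    calc ‖u a * ∏ a ∈ s, u a - v a * ∏ a ∈ s, v a‖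
        = ‖(u a - v a) * ∏ a ∈ s, v a + u a * (∏ a ∈ s, u a - ∏ a ∈ s, v a)‖ := by
          congr 1; ring
      _ ≤ ‖u a - v a‖ * M ^ s.card + M * (M ^ s.card * ∑ a ∈ s, ‖u a - v a‖) := by
          refine (norm_add_le _ _).trans ?_
          rw [norm_mul, norm_mul]
          gcongr
          exact hu a
      _ ≤ ‖u a - v a‖ * M ^ (s.card + 1) + M * (M ^ s.card * ∑ a ∈ s, ‖u a - v a‖) := by
          gcongr
      _ = _ := by ring

theorem integrable_of_measurable_of_norm_le {f : AddCircle (2 * Real.pi) → ℂ} {M : ℝ}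
    (hf : Measurable f) (hM : ∀ t, ‖f t‖ ≤ M) : Integrable f AddCircle.haarAddCircle :=
  Integrable.of_bound hf.aestronglyMeasurable M (Eventually.of_forall hM)

theorem norm_integral_pow_sub_le {f q : AddCircle (2 * Real.pi) → ℂ} {M : ℝ} (hM : 1 ≤ M)
    (hf : Measurable f) (hq : Measurable q) (hfM : ∀ t, ‖f t‖ ≤ M) (hqM : ∀ t, ‖q t‖ ≤ M)
    (r : ℕ) :
    ‖∫ t, f t ^ r ∂AddCircle.haarAddCircle - ∫ t, q t ^ r ∂AddCircle.haarAddCircle‖ ≤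
      M ^ r * r * ∫ t, ‖f t - q t‖ ∂AddCircle.haarAddCircle := by
  have hint : ∀ g : AddCircle (2 * Real.pi) → ℂ, Measurable g → (∀ t, ‖g t‖ ≤ M) →
      Integrable (fun t => g t ^ r) AddCircle.haarAddCircle := fun g hg hgM =>
    integrable_of_measurable_of_norm_le (M := M ^ r) (hg.pow_const r) fun t => by
      rw [norm_pow]; gcongr; exact hgM t
  rw [← integral_sub (hint f hf hfM) (hint q hq hqM), ← integral_const_mul]
  refine norm_integral_le_of_norm_le (Integrable.const_mul ?_ _) (Eventually.of_forall fun t => ?_)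
  · exact ((integrable_of_measurable_of_norm_le hf hfM).sub
      (integrable_of_measurable_of_norm_le hq hqM)).norm
  · have h := norm_prod_sub_prod_le (Finset.univ : Finset (Fin r)) (fun _ => f t) (fun _ => q t)
      hM (fun _ => hfM t) (fun _ => hqM t)
    simpa [mul_assoc] using h

/-- The trigonometric polynomial with coefficients `c`. -/
noncomputable def trigPoly (c : ℤ →₀ ℂ) (t : AddCircle (2 * Real.pi)) : ℂ :=
  ∑ m ∈ c.support, c m * fourier m t

theorem continuous_trigPoly (c : ℤ →₀ ℂ) : Continuous (trigPoly c) :=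
  continuous_finsetSum _ fun m _ => continuous_const.mul (fourier m).continuous

theorem integrable_of_continuous {g : AddCircle (2 * Real.pi) → ℂ} (hg : Continuous g) :
    Integrable g AddCircle.haarAddCircle :=
  hg.integrable_of_hasCompactSupport (HasCompactSupport.of_compactSpace g)

theorem integral_fourier_mul_trigPoly (c : ℤ →₀ ℂ) (l : ℤ) :
    ∫ t, fourier l t * trigPoly c t ∂AddCircle.haarAddCircle = c (-l) := by
  have h : ∀ t, fourier l t * trigPoly c t = ∑ m ∈ c.support, c m * fourier (l + m) t := by
    intro t
    rw [trigPoly, Finset.mul_sum]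
    exact Finset.sum_congr rfl fun m _ => by rw [fourier_add]; ring
  simp only [h]
  rw [integral_finsetSum _ fun m _ =>
    (integrable_of_continuous (fourier (l + m)).continuous).const_mul (c m)]
  simp only [integral_const_mul, integral_fourier]
  rw [Finset.sum_eq_single (-l)]
  · simp
  · intro m _ hm
    rw [if_neg fun h => hm (by omega), mul_zero]
  · intro hl
    simp [Finsupp.notMem_support_iff.1 hl]

theorem integral_trigPoly_pow {B : Type*} [DecidableEq B] [Fintype B] (c : ℤ →₀ ℂ) :
    ∫ t, trigPoly c t ^ Fintype.card B ∂AddCircle.haarAddCircle =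
      ∑ m ∈ Fintype.piFinset fun _ : B => c.support,
        (∏ W, c (m W)) * if ∑ W, m W = 0 then 1 else 0 := by
  classical
  have h : ∀ t, trigPoly c t ^ Fintype.card B = ∑ m ∈ Fintype.piFinset fun _ : B => c.support,
      (∏ W, c (m W)) * fourier (∑ W, m W) t := by
    intro t
    rw [← Finset.card_univ, ← Finset.prod_const, trigPoly, Finset.prod_univ_sum]
    exact Finset.sum_congr rfl fun m _ => by rw [Finset.prod_mul_distrib, fourier_sum]
  simp only [h]
  rw [integral_finsetSum _ fun m _ =>
    (integrable_of_continuous (fourier _).continuous).const_mul _]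
  simp only [integral_const_mul, integral_fourier]

/-- Approximate in `L¹` by a continuous function, then uniformly by a trigonometric polynomial. The
sup bound is needed because the `L¹` continuity of walk integrals holds only on bounded sets. -/
theorem exists_trigPoly_approx {f : AddCircle (2 * Real.pi) → ℝ} {M : ℝ} (hf : Measurable f)
    (hM : ∀ t, |f t| ≤ M) {ε : ℝ} (hε : 0 < ε) (hε1 : ε ≤ 1) :
    ∃ c : ℤ →₀ ℂ, (∀ t, ‖trigPoly c t‖ ≤ M + 1) ∧
      ∫ t, ‖(f t : ℂ) - trigPoly c t‖ ∂AddCircle.haarAddCircle ≤ ε := by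
  have hM0 : 0 ≤ M := (abs_nonneg _).trans (hM 0)
  have hfint : Integrable f (AddCircle.haarAddCircle (T := 2 * Real.pi)) :=
    Integrable.of_bound hf.aestronglyMeasurable M (Eventually.of_forall hM)
  obtain ⟨g, hg, hgint⟩ := hfint.exists_boundedContinuous_integral_sub_le (half_pos hε)
  -- Truncation to `[-M, M]` is 1-Lipschitz and fixes `f`, so it does not worsen the `L¹` error.
  set k : C(AddCircle (2 * Real.pi), ℂ) :=
    ⟨fun t => ((max (-M) (min M (g t)) : ℝ) : ℂ), by fun_prop⟩ with hk
  have hkM : ∀ t, ‖k t‖ ≤ M := by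
    intro t
    simp only [hk, ContinuousMap.coe_mk, Complex.norm_real, Real.norm_eq_abs]
    exact abs_le.2 ⟨le_max_left _ _, max_le (by linarith) (min_le_left _ _)⟩
  have hkf : ∀ t, ‖(f t : ℂ) - k t‖ ≤ ‖f t - g t‖ := by
    intro t
    simp only [hk, ContinuousMap.coe_mk]
    rw [← Complex.ofReal_sub, Complex.norm_real, Real.norm_eq_abs, Real.norm_eq_abs]
    have hft : f t = max (-M) (min M (f t)) := by
      rw [min_eq_right (abs_le.1 (hM t)).2, max_eq_right (abs_le.1 (hM t)).1]
    conv_lhs => rw [hft]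
    refine (abs_max_sub_max_le_max _ _ _ _).trans ?_
    rw [sub_self, abs_zero]
    refine max_le (abs_nonneg _) ((abs_min_sub_min_le_max _ _ _ _).trans ?_)
    rw [sub_self, abs_zero]
    exact max_le (abs_nonneg _) le_rfl
  have hdense : k ∈ closure ((Submodule.span ℂ (Set.range (@fourier (2 * Real.pi))) :
      Submodule ℂ C(AddCircle (2 * Real.pi), ℂ)) : Set C(AddCircle (2 * Real.pi), ℂ)) := by
    rw [← Submodule.topologicalClosure_coe, span_fourier_closure_eq_top]
    trivial
  obtain ⟨q, hq, hkq⟩ := Metric.mem_closure_iff.1 hdense (ε / 2) (half_pos hε)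
  obtain ⟨c, rfl⟩ := (Finsupp.mem_span_range_iff_exists_finsupp).1 hq
  have hc : ∀ t, (c.sum fun m a => a • fourier m : C(AddCircle (2 * Real.pi), ℂ)) t =
      trigPoly c t := by
    intro t
    simp [Finsupp.sum, trigPoly, ContinuousMap.sum_apply]
  have hkc : ∀ t, ‖k t - trigPoly c t‖ ≤ ε / 2 := by
    intro t
    rw [← hc, ← dist_eq_norm]
    exact (ContinuousMap.dist_apply_le_dist t).trans hkq.le
  refine ⟨c, fun t => ?_, ?_⟩
  · calc ‖trigPoly c t‖ = ‖k t - (k t - trigPoly c t)‖ := by rw [sub_sub_cancel]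
      _ ≤ M + ε / 2 := (norm_sub_le _ _).trans (add_le_add (hkM t) (hkc t))
      _ ≤ M + 1 := by linarith
  · have hfg : Integrable (fun t => ‖f t - g t‖) AddCircle.haarAddCircle :=
      (hfint.sub hgint).norm
    calc ∫ t, ‖(f t : ℂ) - trigPoly c t‖ ∂AddCircle.haarAddCircle
        ≤ ∫ t, (‖f t - g t‖ + ε / 2) ∂AddCircle.haarAddCircle := by
          refine integral_mono ?_ (hfg.add (integrable_const _)) fun t => ?_
          · exact (hfint.ofReal.sub (integrable_of_continuous (continuous_trigPoly c))).norm
          · calc ‖(f t : ℂ) - trigPoly c t‖ = ‖((f t : ℂ) - k t) + (k t - trigPoly c t)‖ := by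
                  rw [sub_add_sub_cancel]
              _ ≤ _ := (norm_add_le _ _).trans (add_le_add (hkf t) (hkc t))
      _ = ∫ t, ‖f t - g t‖ ∂AddCircle.haarAddCircle + ε / 2 := by
          rw [integral_add hfg (integrable_const _)]
          simp
      _ ≤ ε := by linarith

/-! ### Walk integrals and their limits -/

section Walk

variable {n : ℕ} [NeZero n] {B : Type*} [DecidableEq B] [Fintype B] (b : Fin n → B)

theorem prod_circleKernel_eq (N : ℕ) (x : B → AddCircle (2 * Real.pi)) :
    ∏ k, circleKernel N (x (b (k - 1)) - x (b k)) =
      ∑ i : Fin n → Fin N, ∏ W,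
        fourier (flowDivergence b (fun k => ((i k : ℕ) : ℤ)) W) (x W) := by
  simp only [circleKernel]
  rw [Finset.prod_univ_sum, Fintype.piFinset_univ]
  refine Finset.sum_congr rfl fun i _ => ?_
  simp only [fourier_sub_apply]
  rw [Finset.prod_mul_distrib, ← Equiv.prod_comp (Equiv.addRight (1 : Fin n))
    (fun k => fourier ((i k : ℕ) : ℤ) (x (b (k - 1)))), ← Finset.prod_mul_distrib]
  simp only [Equiv.coe_addRight, add_sub_cancel_right, ← fourier_add, ← sub_eq_add_neg]
  rw [← Finset.prod_fiberwise _ b]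
  refine Finset.prod_congr rfl fun W _ => ?_
  rw [flowDivergence, fourier_sum]
  refine Finset.prod_congr rfl fun k hk => ?_
  rw [(Finset.mem_filter.1 hk).2]

/-- The normalized integral of the kernel of the closed walk `b` against `f ⊗ ⋯ ⊗ f`. -/
noncomputable def walkIntegral (f : AddCircle (2 * Real.pi) → ℂ) (N : ℕ) : ℂ :=
  1 / (N : ℂ) ^ (n + 1 - Fintype.card B) *
    ∫ x, (∏ k, circleKernel N (x (b (k - 1)) - x (b k))) * ∏ W, f (x W) ∂torusMeasure B

theorem walkIntegral_eq_sum {f : AddCircle (2 * Real.pi) → ℂ} {M : ℝ}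
    (hf : Measurable f) (hM : ∀ t, ‖f t‖ ≤ M) (N : ℕ) :
    walkIntegral b f N = 1 / (N : ℂ) ^ (n + 1 - Fintype.card B) *
      ∑ i : Fin n → Fin N, ∏ W, ∫ t,
        fourier (flowDivergence b (fun k => ((i k : ℕ) : ℤ)) W) t * f t
          ∂AddCircle.haarAddCircle := by
  rw [walkIntegral]
  congr 1
  simp only [prod_circleKernel_eq, Finset.sum_mul, ← Finset.prod_mul_distrib]
  rw [integral_finsetSum]
  · refine Finset.sum_congr rfl fun i _ => ?_
    exact integral_fintype_prod_eq_prod (μ := fun _ : B => AddCircle.haarAddCircle)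
      (fun W t => fourier (flowDivergence b (fun k => ((i k : ℕ) : ℤ)) W) t * f t)
  · intro i _
    refine Integrable.fintype_prod (f := fun W t =>
      fourier (flowDivergence b (fun k => ((i k : ℕ) : ℤ)) W) t * f t) fun W => ?_
    refine integrable_of_measurable_of_norm_le (M := M)
      ((fourier _).continuous.measurable.mul hf) fun t => ?_
    rw [norm_mul, fourier_apply, Circle.norm_coe, one_mul]
    exact hM t

/-- The walk integrals depend on `f` continuously in `L¹`, on bounded sets and uniformly in `N`. -/
theorem exists_norm_walkIntegral_sub_le (hb : Function.Surjective b) {M : ℝ} (hM : 1 ≤ M) :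
    ∃ C : ℝ, 0 ≤ C ∧ ∀ f q : AddCircle (2 * Real.pi) → ℂ, Measurable f → Measurable q →
      (∀ t, ‖f t‖ ≤ M) → (∀ t, ‖q t‖ ≤ M) → ∀ N : ℕ, 0 < N →
      ‖walkIntegral b f N - walkIntegral b q N‖ ≤
        C * ∫ t, ‖f t - q t‖ ∂AddCircle.haarAddCircle := by
  obtain ⟨C, hC, hCN⟩ := exists_integral_prod_kernelRatio_le b hb
  have hM0 : 0 ≤ M := zero_le_one.trans hM
  set r := Fintype.card B with hr
  have hr1 : 1 ≤ r := Fintype.card_pos_iff.2 ⟨b 0⟩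
  have hrn : r ≤ n := by simpa using Fintype.card_le_of_surjective b hb
  refine ⟨M ^ r * (r * C), by positivity, fun f q hf hq hfM hqM N hN => ?_⟩
  have hN' : (0 : ℝ) < N := by exact_mod_cast hN
  have hcont : Continuous fun x : B → AddCircle (2 * Real.pi) =>
      ∏ k, circleKernel N (x (b (k - 1)) - x (b k)) :=
    continuous_finsetProd _ fun k _ => (continuous_circleKernel N).comp
      ((continuous_apply _).sub (continuous_apply _))
  have hint : ∀ g : AddCircle (2 * Real.pi) → ℂ, Measurable g → (∀ t, ‖g t‖ ≤ M) →
      Integrable (fun x : B → AddCircle (2 * Real.pi) =>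
        (∏ k, circleKernel N (x (b (k - 1)) - x (b k))) * ∏ W, g (x W)) (torusMeasure B) := by
    intro g hg hgM
    refine Integrable.of_bound (C := (∏ _k : Fin n, (N : ℝ)) * ∏ _W : B, M) ?_
      (Eventually.of_forall fun x => ?_)
    · have := hcont.measurable
      exact (this.mul (by fun_prop)).aestronglyMeasurable
    · rw [norm_mul, norm_prod, norm_prod]
      gcongr
      · exact norm_circleKernel_le N _
      · exact hgM _
  have hdiff : Measurable fun t => ‖f t - q t‖ := (hf.sub hq).norm
  have hdiffM : ∀ t, ‖f t - q t‖ ≤ M + M := fun t =>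
    (norm_sub_le _ _).trans (add_le_add (hfM t) (hqM t))
  have hint2 : ∀ W : B, Integrable (fun x : B → AddCircle (2 * Real.pi) =>
      (∏ k, kernelRatio N (x (b (k - 1)) - x (b k))) * ‖f (x W) - q (x W)‖)
      (torusMeasure B) := by
    intro W
    refine Integrable.of_bound (C := M + M) ?_ (Eventually.of_forall fun x => ?_)
    · have := (continuous_kernelRatio N).measurable
      exact (Measurable.aestronglyMeasurable (by fun_prop))
    · rw [Real.norm_of_nonneg (mul_nonneg (Finset.prod_nonneg fun _ _ => kernelRatio_nonneg N _)
        (norm_nonneg _))]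
      exact (mul_le_of_le_one_left (norm_nonneg _)
        (Finset.prod_le_one (fun _ _ => kernelRatio_nonneg N _)
          fun _ _ => kernelRatio_le_one N _)).trans (hdiffM _)
  -- Normalizing the `n` kernels costs `N ^ n`: one part cancels the prefactor, the other is
  -- absorbed by the uniform `L¹` bound.
  have hpow : (N : ℝ) ^ n = (N : ℝ) ^ (n + 1 - r) * (N : ℝ) ^ (r - 1) := by
    rw [← pow_add]; congr 1; omega
  rw [walkIntegral, walkIntegral, ← mul_sub, ← integral_sub (hint f hf hfM) (hint q hq hqM),
    norm_mul]
  calc ‖(1 : ℂ) / (N : ℂ) ^ (n + 1 - r)‖ *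
        ‖∫ x, ((∏ k, circleKernel N (x (b (k - 1)) - x (b k))) * ∏ W, f (x W) -
          (∏ k, circleKernel N (x (b (k - 1)) - x (b k))) * ∏ W, q (x W)) ∂torusMeasure B‖
      ≤ ‖(1 : ℂ) / (N : ℂ) ^ (n + 1 - r)‖ * ∫ x, (N : ℝ) ^ n * (M ^ r * ∑ W,
          (∏ k, kernelRatio N (x (b (k - 1)) - x (b k))) * ‖f (x W) - q (x W)‖)
          ∂torusMeasure B := by
        refine mul_le_mul_of_nonneg_left (norm_integral_le_of_norm_le ?_
          (Eventually.of_forall fun x => ?_)) (norm_nonneg _)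
        · exact ((integrable_finsetSum _ fun W _ => hint2 W).const_mul _).const_mul _
        · rw [← mul_sub, norm_mul, norm_prod, ← Finset.mul_sum]
          have h1 : ∏ k, ‖circleKernel N (x (b (k - 1)) - x (b k))‖ =
              (N : ℝ) ^ n * ∏ k, kernelRatio N (x (b (k - 1)) - x (b k)) := by
            simp only [kernelRatio]
            rw [Finset.prod_div_distrib, Finset.prod_const, Finset.card_univ, Fintype.card_fin,
              mul_div_cancel₀ _ (by positivity)]
          have h2 := norm_prod_sub_prod_le Finset.univ (fun W => f (x W)) (fun W => q (x W)) hM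
            (fun W => hfM _) (fun W => hqM _)
          rw [Finset.card_univ, ← hr] at h2
          rw [h1, mul_assoc, mul_left_comm (M ^ r)]
          refine mul_le_mul_of_nonneg_left (mul_le_mul_of_nonneg_left h2 ?_) (by positivity)
          exact Finset.prod_nonneg fun _ _ => kernelRatio_nonneg N _
    _ = M ^ r * ∑ W, (N : ℝ) ^ (r - 1) *
          ∫ x, (∏ k, kernelRatio N (x (b (k - 1)) - x (b k))) * ‖f (x W) - q (x W)‖
          ∂torusMeasure B := by
        rw [integral_const_mul, integral_const_mul, integral_finsetSum _ fun W _ => hint2 W,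
          ← Finset.mul_sum, norm_div, norm_one, norm_pow, Complex.norm_natCast, hpow]
        field_simp
    _ ≤ M ^ r * ∑ _W : B, C * ∫ t, ‖f t - q t‖ ∂AddCircle.haarAddCircle := by
        refine mul_le_mul_of_nonneg_left (Finset.sum_le_sum fun W _ => ?_) (by positivity)
        exact hCN N hN W (fun t => ‖f t - q t‖) (M + M) hdiff (fun t => norm_nonneg _) hdiffM
    _ = _ := by
        rw [Finset.sum_const, Finset.card_univ, nsmul_eq_mul]
        ring

/-- Group the flows by divergence. The sign in `-m` appears because integrating against frequency
`l` extracts the coefficient at `-l`. -/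
theorem walkIntegral_trigPoly (c : ℤ →₀ ℂ) (N : ℕ) :
    walkIntegral b (trigPoly c) N = ∑ m ∈ Fintype.piFinset fun _ : B => c.support,
      (∏ W, c (m W)) * ((flowCount b (-m) N : ℂ) / (N : ℂ) ^ (n + 1 - Fintype.card B)) := by
  obtain ⟨M, hM⟩ : ∃ M, ∀ t, ‖trigPoly c t‖ ≤ M := by
    obtain ⟨M, hM⟩ := isCompact_univ.exists_bound_of_continuousOn (continuous_trigPoly c).continuousOn
    exact ⟨M, fun t => hM t trivial⟩
  rw [walkIntegral_eq_sum b (continuous_trigPoly c).measurable hM]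
  simp only [integral_fourier_mul_trigPoly]
  have hfib : ∀ i : Fin n → Fin N,
      ∏ W, c (-flowDivergence b (fun k => ((i k : ℕ) : ℤ)) W) =
      ∑ m ∈ Fintype.piFinset fun _ : B => c.support, (∏ W, c (m W)) *
        if ∀ W, flowDivergence b (fun k => ((i k : ℕ) : ℤ)) W = (-m) W then 1 else 0 := by
    intro i
    set s : B → ℤ := fun W => -flowDivergence b (fun k => ((i k : ℕ) : ℤ)) W with hs
    have hcond : ∀ m : B → ℤ,
        (∀ W, flowDivergence b (fun k => ((i k : ℕ) : ℤ)) W = (-m) W) ↔ m = s := by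
      intro m
      rw [funext_iff]
      refine forall_congr' fun W => ?_
      simp only [hs, Pi.neg_apply]
      omega
    simp only [hcond, mul_ite, mul_one, mul_zero, Finset.sum_ite_eq']
    split_ifs with h
    · rfl
    -- A divergence outside the finite box of frequencies meets a zero coefficient.
    · have : ∃ W, c (s W) = 0 := by
        by_contra! hne
        exact h (Fintype.mem_piFinset.2 fun W => Finsupp.mem_support_iff.2 (hne W))
      obtain ⟨W, hW⟩ := this
      exact Finset.prod_eq_zero (Finset.mem_univ W) hW
  simp only [hfib]
  rw [Finset.sum_comm, Finset.mul_sum]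
  refine Finset.sum_congr rfl fun m _ => ?_
  rw [← Finset.mul_sum, Finset.sum_boole, flowCount]
  ring

theorem tendsto_walkIntegral_trigPoly (hb : Function.Surjective b) {V : ℝ}
    (hV : Tendsto (fun N : ℕ => (flowCount b 0 N : ℝ) / (N : ℝ) ^ (n + 1 - Fintype.card B))
      atTop (𝓝 V)) (c : ℤ →₀ ℂ) :
    Tendsto (walkIntegral b (trigPoly c)) atTop
      (𝓝 (V * ∫ t, trigPoly c t ^ Fintype.card B ∂AddCircle.haarAddCircle)) := by
  rw [integral_trigPoly_pow, Finset.mul_sum, funext (walkIntegral_trigPoly b c)]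
  refine tendsto_finsetSum _ fun m _ => ?_
  rw [mul_left_comm]
  refine Tendsto.const_mul _ ?_
  by_cases hm : ∑ W, m W = 0
  · rw [if_pos hm, mul_one]
    have h := tendsto_flowCount b hb hV (-m) (by simpa using hm)
    have h' := (Complex.continuous_ofReal.tendsto V).comp h
    refine h'.congr fun N => ?_
    simp
  · rw [if_neg hm, mul_zero]
    refine tendsto_const_nhds.congr fun N => ?_
    rw [flowCount_eq_zero b (-m) (by simpa using hm)]
    simp

/-- The limit of the walk integrals of a bounded measurable function. -/
theorem tendsto_walkIntegral (hb : Function.Surjective b) {V : ℝ}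
    (hV : Tendsto (fun N : ℕ => (flowCount b 0 N : ℝ) / (N : ℝ) ^ (n + 1 - Fintype.card B))
      atTop (𝓝 V)) {f : AddCircle (2 * Real.pi) → ℝ} {M : ℝ} (hf : Measurable f)
    (hM : ∀ t, |f t| ≤ M) :
    Tendsto (walkIntegral b fun t => (f t : ℂ)) atTop
      (𝓝 (V * ∫ t, (f t : ℂ) ^ Fintype.card B ∂AddCircle.haarAddCircle)) := by
  have hM0 : 0 ≤ M := (abs_nonneg _).trans (hM 0)
  obtain ⟨C, hC, hCN⟩ := exists_norm_walkIntegral_sub_le b hb (M := M + 1) (by linarith)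
  -- `D` is a Lipschitz constant in `L¹` for the limit functional, as `C` is for the walk integrals;
  -- `δ` keeps both errors below `ε / 3`.
  set D := |V| * ((M + 1) ^ Fintype.card B * Fintype.card B) with hD
  have hD0 : 0 ≤ D := by positivity
  rw [Metric.tendsto_nhds]
  intro ε hε
  set δ := min 1 (ε / (3 * (C + D + 1))) with hδ
  have hδ0 : 0 < δ := lt_min one_pos (by positivity)
  have hCδ : C * δ < ε / 3 ∧ D * δ < ε / 3 := by
    have h1 : (C + D + 1) * δ ≤ ε / 3 := by
      calc (C + D + 1) * δ ≤ (C + D + 1) * (ε / (3 * (C + D + 1))) := by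
            gcongr
            exact min_le_right _ _
        _ = ε / 3 := by field_simp
    constructor <;> nlinarith [mul_nonneg hC hδ0.le, mul_nonneg hD0 hδ0.le]
  obtain ⟨c, hc, hfc⟩ := exists_trigPoly_approx hf hM hδ0 (min_le_left _ _)
  have hfm : Measurable fun t => (f t : ℂ) := Complex.measurable_ofReal.comp hf
  have hfM : ∀ t, ‖(f t : ℂ)‖ ≤ M + 1 := fun t => by
    rw [Complex.norm_real, Real.norm_eq_abs]
    linarith [hM t]
  have hcm := (continuous_trigPoly c).measurable
  have hlim := Metric.tendsto_nhds.1 (tendsto_walkIntegral_trigPoly b hb hV c) (ε / 3)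
    (by positivity)
  filter_upwards [hlim, eventually_gt_atTop 0] with N hN hN0
  have h1 := (hCN _ _ hfm hcm hfM hc N hN0).trans (mul_le_mul_of_nonneg_left hfc hC)
  have h2 : ‖(V : ℂ) * ∫ t, (f t : ℂ) ^ Fintype.card B ∂AddCircle.haarAddCircle -
      V * ∫ t, trigPoly c t ^ Fintype.card B ∂AddCircle.haarAddCircle‖ ≤ D * δ := by
    rw [← mul_sub, norm_mul, Complex.norm_real, Real.norm_eq_abs, hD, mul_assoc]
    gcongr
    exact (norm_integral_pow_sub_le (by linarith) hfm hcm hfM hc _).trans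
      (mul_le_mul_of_nonneg_left hfc (by positivity))
  calc dist (walkIntegral b (fun t => (f t : ℂ)) N) _
      ≤ dist (walkIntegral b (fun t => (f t : ℂ)) N) (walkIntegral b (trigPoly c) N) +
        dist (walkIntegral b (trigPoly c) N)
          (V * ∫ t, trigPoly c t ^ Fintype.card B ∂AddCircle.haarAddCircle) +
        dist ((V : ℂ) * ∫ t, trigPoly c t ^ Fintype.card B ∂AddCircle.haarAddCircle)
          (V * ∫ t, (f t : ℂ) ^ Fintype.card B ∂AddCircle.haarAddCircle) :=
        dist_triangle4 _ _ _ _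
    _ < ε := by
        rw [dist_eq_norm, dist_comm ((V : ℂ) * _), dist_eq_norm ((V : ℂ) * _)]
        linarith [hCδ.1, hCδ.2]

end Walk

/-! ### Transfer between the interval and the circle -/

theorem integral_haarAddCircle_eq_setIntegral (h : AddCircle (2 * Real.pi) → ℂ) :
    ∫ t, h t ∂AddCircle.haarAddCircle =
      ((2 * Real.pi : ℝ) : ℂ)⁻¹ * ∫ x in Set.Ico 0 (2 * Real.pi), h (x : ℝ) := by
  rw [AddCircle.integral_haarAddCircle, ← AddCircle.intervalIntegral_preimage _ 0, zero_add,
    intervalIntegral.integral_of_le Real.two_pi_pos.le, ← integral_Ico_eq_integral_Ioc,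
    Complex.real_smul, Complex.ofReal_inv]

/-- The periodic extension of a function on `[0, 2π)`. -/
noncomputable def circleLift (p : ℝ → ℝ) (t : AddCircle (2 * Real.pi)) : ℝ :=
  (Set.Ico 0 (2 * Real.pi)).indicator p (AddCircle.measurableEquivIco (2 * Real.pi) 0 t)

theorem circleLift_coe (p : ℝ → ℝ) {x : ℝ} (hx : x ∈ Set.Ico 0 (2 * Real.pi)) :
    circleLift p x = p x := by
  have h : (AddCircle.measurableEquivIco (2 * Real.pi) 0 (x : AddCircle (2 * Real.pi)) : ℝ) = x := by
    have := AddCircle.equivIco_coe_of_mem (p := 2 * Real.pi) (a := 0)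
      (y := x) (by simpa using hx)
    exact this
  rw [circleLift, h, Set.indicator_of_mem hx]

theorem measurable_circleLift {p : ℝ → ℝ} (hp : ContinuousOn p (Set.Ico 0 (2 * Real.pi))) :
    Measurable (circleLift p) := by
  -- Nothing is assumed about `p` off the interval; the indicator discards those values.
  have h : Measurable ((Set.Ico 0 (2 * Real.pi)).indicator p) := by
    classical
    rw [← Set.piecewise_eq_indicator]
    exact hp.measurable_piecewise continuousOn_const measurableSet_Ico
  exact h.comp (measurable_subtype_coe.comp (MeasurableEquiv.measurable _))

theorem blockOf_surjective {n : ℕ} (ρ : Finpartition (Finset.univ : Finset (Fin n))) :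
    Function.Surjective (blockOf ρ) := by
  rintro ⟨W, hW⟩
  obtain ⟨k, hk⟩ := ρ.nonempty_of_mem_parts hW
  exact ⟨k, Subtype.ext (ρ.part_eq_of_mem hW hk)⟩

/-- Both sides are the same finite sum of products of Fourier coefficients, so agreement of the
coefficients suffices. -/
theorem expansionCoeff_eq_walkIntegral {n : ℕ} [NeZero n]
    (ρ : Finpartition (Finset.univ : Finset (Fin n))) (μ : Measure ℝ) [IsProbabilityMeasure μ]
    {f : AddCircle (2 * Real.pi) → ℝ} {M : ℝ} (hf : Measurable f) (hM : ∀ t, |f t| ≤ M)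
    (hμ : ∀ m : ℤ, ∫ x, fourier m (x : AddCircle (2 * Real.pi)) ∂μ =
      ∫ t, fourier m t * (f t : ℂ) ∂AddCircle.haarAddCircle) (N : ℕ) :
    expansionCoeff ρ μ N = walkIntegral (blockOf ρ) (fun t => (f t : ℂ)) N := by
  have hfc : Measurable fun t => (f t : ℂ) := Complex.measurable_ofReal.comp hf
  rw [walkIntegral_eq_sum (blockOf ρ) (M := M) hfc
    (fun t => by simpa using hM t), expansionCoeff, Fintype.card_coe]
  congr 1
  have h : ∀ x : {W : Finset (Fin n) // W ∈ ρ.parts} → ℝ,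
      ∏ k : Fin n, vandermondeKernel N (x (blockOf ρ (k - 1)) - x (blockOf ρ k)) =
      ∑ i : Fin n → Fin N, ∏ W,
        fourier (flowDivergence (blockOf ρ) (fun k => ((i k : ℕ) : ℤ)) W)
          (x W : AddCircle (2 * Real.pi)) := by
    intro x
    rw [← prod_circleKernel_eq (blockOf ρ) N fun W => (x W : AddCircle (2 * Real.pi))]
    refine Finset.prod_congr rfl fun k _ => ?_
    rw [← circleKernel_coe, AddCircle.coe_sub]
  simp only [h, ← hμ]
  rw [integral_finsetSum]
  · refine Finset.sum_congr rfl fun i _ => ?_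
    exact integral_fintype_prod_eq_prod (μ := fun _ => μ)
      (fun W (x : ℝ) => fourier (flowDivergence (blockOf ρ) (fun k => ((i k : ℕ) : ℤ)) W)
        (x : AddCircle (2 * Real.pi)))
  · intro i _
    refine Integrable.fintype_prod (f := fun W (x : ℝ) =>
      fourier (flowDivergence (blockOf ρ) (fun k => ((i k : ℕ) : ℤ)) W)
        (x : AddCircle (2 * Real.pi))) fun W => ?_
    refine Integrable.of_bound (C := 1) ?_ (Eventually.of_forall fun x => ?_)
    · exact ((fourier _).continuous.comp (AddCircle.continuous_mk' _)).aestronglyMeasurable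
    · rw [fourier_apply, Circle.norm_coe]

theorem integral_fourier_withDensity {p : ℝ → ℝ}
    (hp_nonneg : ∀ x ∈ Set.Ico 0 (2 * Real.pi), 0 ≤ p x)
    (hp_cont : ContinuousOn p (Set.Ico 0 (2 * Real.pi))) (m : ℤ) :
    ∫ x, fourier m (x : AddCircle (2 * Real.pi))
        ∂(volume.restrict (Set.Ico 0 (2 * Real.pi))).withDensity (fun x => ENNReal.ofReal (p x)) =
      ∫ t, fourier m t * ((2 * Real.pi * circleLift p t : ℝ) : ℂ) ∂AddCircle.haarAddCircle := by
  have hpm : AEMeasurable p (volume.restrict (Set.Ico 0 (2 * Real.pi))) :=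
    hp_cont.aemeasurable measurableSet_Ico
  rw [integral_withDensity_eq_integral_toReal_smul₀ hpm.ennreal_ofReal
      (Eventually.of_forall fun x => ENNReal.ofReal_lt_top),
    integral_haarAddCircle_eq_setIntegral, ← integral_const_mul]
  refine setIntegral_congr_fun measurableSet_Ico fun x hx => ?_
  rw [ENNReal.toReal_ofReal (hp_nonneg x hx), circleLift_coe p hx, Complex.real_smul]
  have : (Real.pi : ℂ) ≠ 0 := by exact_mod_cast Real.pi_ne_zero
  push_cast
  field_simp

instance isProbabilityMeasure_uniformPhase : IsProbabilityMeasure uniformPhase :=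
  ProbabilityTheory.cond_isProbabilityMeasure_of_finite (by simp [Real.pi_pos]) measure_Ico_lt_top.ne

theorem integral_fourier_uniformPhase (m : ℤ) :
    ∫ x, fourier m (x : AddCircle (2 * Real.pi)) ∂uniformPhase =
      ∫ t : AddCircle (2 * Real.pi), fourier m t * ((1 : ℝ) : ℂ) ∂AddCircle.haarAddCircle := by
  rw [integral_haarAddCircle_eq_setIntegral, uniformPhase, ProbabilityTheory.cond,
    integral_smul_measure, Real.volume_Ico, sub_zero, ENNReal.toReal_inv,
    ENNReal.toReal_ofReal Real.two_pi_pos.le, Complex.real_smul, Complex.ofReal_inv]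
  simp only [Complex.ofReal_one, mul_one]

theorem theorem3 (μ : Measure ℝ) [IsProbabilityMeasure μ] (p : ℝ → ℝ)
    (hp_nonneg : ∀ x ∈ Set.Ico 0 (2 * Real.pi), 0 ≤ p x)
    (hp_density : μ = (volume.restrict (Set.Ico 0 (2 * Real.pi))).withDensity
      (fun x => ENNReal.ofReal (p x)))
    (hp_cont : ContinuousOn p (Set.Ico 0 (2 * Real.pi)))
    (hp_bdd : BddAbove (p '' Set.Ico 0 (2 * Real.pi)))
    (n : ℕ) [NeZero n] (ρ : Finpartition (Finset.univ : Finset (Fin n))) :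
    ∃ Ku Kω : ℂ, IsExpansionCoeff ρ uniformPhase Ku ∧ IsExpansionCoeff ρ μ Kω ∧
      Kω = Ku * (((2 * Real.pi) ^ (ρ.parts.card - 1) *
        ∫ x in (0 : ℝ)..(2 * Real.pi), p x ^ ρ.parts.card : ℝ) : ℂ) := by
  set b := blockOf ρ
  have hb : Function.Surjective b := blockOf_surjective ρ
  obtain ⟨V, hV⟩ := exists_tendsto_flowCount_zero b hb
  obtain ⟨M, hM⟩ := hp_bdd
  have hpi := Real.two_pi_pos
  set f : AddCircle (2 * Real.pi) → ℝ := fun t => 2 * Real.pi * circleLift p t with hf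
  have hfm : Measurable f := (measurable_circleLift hp_cont).const_mul _
  have hfM : ∀ t, |f t| ≤ 2 * Real.pi * M := by
    intro t
    set x := AddCircle.measurableEquivIco (2 * Real.pi) 0 t
    have hx : (x : ℝ) ∈ Set.Ico 0 (2 * Real.pi) := by simpa using x.2
    have ht : circleLift p t = p x := Set.indicator_of_mem hx p
    rw [hf]
    simp only [ht]
    rw [abs_of_nonneg (mul_nonneg hpi.le (hp_nonneg _ hx))]
    exact mul_le_mul_of_nonneg_left (hM ⟨x, hx, rfl⟩) hpi.le
  have hu := tendsto_walkIntegral b hb hV (f := fun _ => 1) (M := 1) measurable_const (by simp)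
  have hω := tendsto_walkIntegral b hb hV hfm hfM
  refine ⟨_, _, hu.congr fun N => ?_, hω.congr fun N => ?_, ?_⟩
  · exact (expansionCoeff_eq_walkIntegral ρ uniformPhase measurable_const (M := 1) (by simp)
      integral_fourier_uniformPhase N).symm
  · refine (expansionCoeff_eq_walkIntegral ρ μ hfm hfM (fun m => ?_) N).symm
    rw [hp_density]
    exact integral_fourier_withDensity hp_nonneg hp_cont m
  -- A partition of a nonempty set has a block, so the exponent `ρ.parts.card - 1` is not truncated.
  · have hcard : 1 ≤ ρ.parts.card := Finset.card_pos.2 ⟨_, (b 0).2⟩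
    rw [Fintype.card_coe]
    simp only [Complex.ofReal_one, one_pow, integral_const, probReal_univ, one_smul, mul_one]
    congr 1
    rw [integral_haarAddCircle_eq_setIntegral, Complex.ofReal_mul ((2 * Real.pi) ^ _),
      intervalIntegral.integral_of_le hpi.le, ← integral_Ico_eq_integral_Ioc,
      ← integral_complex_ofReal, ← integral_const_mul, ← integral_const_mul]
    refine setIntegral_congr_fun measurableSet_Ico fun x hx => ?_
    simp only [hf, circleLift_coe p hx]
    obtain ⟨r, hr⟩ := Nat.exists_eq_add_of_le' hcard
    have hpi' : (Real.pi : ℂ) ≠ 0 := by exact_mod_cast Real.pi_ne_zero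
    rw [hr, Nat.add_sub_cancel]
    push_cast
    field_simp
    ring
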